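/- Let $M,Q$ be real random variables with $\mathbb P(M\ge 0,\,Q\ge 0)=1$, with an arbitrary joint law. A function $g$ belongs to $\mathcal R_\rho$ (regularly varying at $+\infty$ with index $\rho$) if, for all large $x$, $g(x)=x^{\rho}L(x)$, where $L$ is positive and measurable on a neighbourhood of $+\infty$ and $L(tx)/L(x)\to1$ as $x\to\infty$ for every $t>0$. Put $$f(x)=-x\log\mathbb P\Big(M\ge 1-\frac1x\Big),\qquad k(x)=-\log\mathbb P(Q>x),$$ and assume that $f\in\mathcal R_r$ and $k\in\mathcal R_\alpha$ for some $r,\alpha>1$. (In particular $M<1$ almost surely.) Let $\beta=\alpha/(\alpha-1)$, $r^\ast=r/(r-1)$, $\gamma=\beta r^\ast/(\beta r^\ast-1)$, and $$h_{co}(x)=\inf_{t\ge1}\Big\{-t\log\min\Big\{\mathbb P\Big(\frac1{1-M}>t\Big),\ \mathbb P\Big(Q>\frac xt\Big)\Big\}\Big\}.$$ A real random variable $R$ is called a perpetuity generated by $(M,Q)$ if $R$ is independent of $(M,Q)$ and $R\stackrel{d}{=}MR+Q$. **Theorem 5.1.** 1. If $R$ is a perpetuity generated by $(M,Q)$, then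 $$\limsup_{x\to\infty}\frac{\log\mathbb P(R>x)}{h_{co}(x)}\le-\Big(\frac{\gamma}{\gamma-1}\Big)^{\gamma-1},$$ where the upper limit is taken in $[-\infty,\infty]$. 2. Let $(M_{co},Q_{co})$ be a comonotonic random vector (on any probability space) with the same marginals as $(M,Q)$, that is, $M_{co}\stackrel{d}{=}M$, $Q_{co}\stackrel{d}{=}Q$ and $$\mathbb P(M_{co}\le x,\,Q_{co}\le y)=\min\{\mathbb P(M\le x),\,\mathbb P(Q\le y)\}\qquad\text{for all }x,y\in\mathbb R,$$ and let $R_{co}$ be a perpetuity generated by $(M_{co},Q_{co})$. Then $$\lim_{x\to\infty}\frac{\log\mathbb P(R_{co}>x)}{h_{co}(x)}=-\Big(\frac{\gamma}{\gamma-1}\Big)^{\gamma-1}.$$ -/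

import Mathlib

open MeasureTheory ProbabilityTheory Filter Topology

namespace Perpetuity

/-- `L` is slowly varying (at `+∞`): positive and measurable on some half-line `(A, ∞)`, with
`L (t x) / L x → 1` as `x → ∞` for every `t > 0`. -/
def IsSlowlyVarying (L : ℝ → ℝ) : Prop :=
  (∃ A : ℝ, (∀ x ∈ Set.Ioi A, 0 < L x) ∧ Measurable (fun x : Set.Ioi A => L x)) ∧
    ∀ t : ℝ, 0 < t → Tendsto (fun x => L (t * x) / L x) atTop (𝓝 1)

/-- `f` is regularly varying (at `+∞`) with index `ρ`, that is `f ∈ R_ρ`: near `+∞` one has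
`f x = x ^ ρ * L x` with `L` slowly varying. In particular `f` is positive near `+∞`. -/
def IsRegularlyVarying (f : ℝ → ℝ) (ρ : ℝ) : Prop :=
  ∃ L : ℝ → ℝ, IsSlowlyVarying L ∧ ∀ᶠ x in atTop, f x = x ^ ρ * L x

variable {Ω : Type*} [MeasurableSpace Ω]

/-- `f(x) = -x log ℙ(M ≥ 1 - 1/x)`. If the probability vanishes for all large `x` then the value
here is `0`, so `IsRegularlyVarying` fails because of positivity, as it has to. -/
noncomputable def fTail (P : Measure Ω) (M : Ω → ℝ) (x : ℝ) : ℝ :=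
  -x * Real.log (P.real {ω | 1 - 1 / x ≤ M ω})

/-- `k(x) = -log ℙ(Q > x)`. -/
noncomputable def kTail (P : Measure Ω) (Q : Ω → ℝ) (x : ℝ) : ℝ :=
  -Real.log (P.real {ω | x < Q ω})

/-- `h_co(x) = inf_{t ≥ 1} { -t log min { ℙ(1/(1-M) > t), ℙ(Q > x/t) } }`. It depends only on the
two marginal laws. It is used where `M < 1` a.s. and both probabilities are positive for
all `t ≥ 1`, so no conventional value of `/` or `log` enters; the infimum is over a nonempty set
of nonnegative reals. -/
noncomputable def hco (P : Measure Ω) (M Q : Ω → ℝ) (x : ℝ) : ℝ :=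
  ⨅ t : Set.Ici (1 : ℝ), -(t : ℝ) * Real.log
    (min (P.real {ω | (t : ℝ) < 1 / (1 - M ω)}) (P.real {ω | x / (t : ℝ) < Q ω}))

/-- `R` is a perpetuity generated by `(M, Q)`: `R` is independent of the pair `(M, Q)` and
`R` has the same distribution as `M R + Q`. -/
structure IsPerpetuity (P : Measure Ω) (M Q R : Ω → ℝ) : Prop where
  measurable : Measurable R
  indep : IndepFun (fun ω => (M ω, Q ω)) R P
  identDistrib : IdentDistrib R (fun ω => M ω * R ω + Q ω) P P

/-- `(X, Y)` is comonotonic: its joint distribution function is the upper Fréchet–Hoeffding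
bound `min {F_X(x), F_Y(y)}`. -/
def IsComonotonic (P : Measure Ω) (X Y : Ω → ℝ) : Prop :=
  ∀ x y : ℝ, P.real {ω | X ω ≤ x ∧ Y ω ≤ y} =
    min (P.real {ω | X ω ≤ x}) (P.real {ω | Y ω ≤ y})

/-- `γ = β r* / (β r* - 1)`, where `β` and `r*` are the conjugate numbers of `α` and `r`
(`Real.conjExponent p = p / (p - 1)`). -/
noncomputable def gammaIndex (α r : ℝ) : ℝ :=
  α.conjExponent * r.conjExponent / (α.conjExponent * r.conjExponent - 1)

end Perpetuity

/-!
Write `T = 1 / (1 - M)`, let `a` and `k` be the logarithmic tails of `T` and `Q`, and let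
`h = h_co`, that is `h x = inf_{t ≥ 1} t * max (a t) (k (x / t))`. The law of `R` is stationary
for the chain `y ↦ M y + Q`. A step with `T = t` and `Q = q` moves `y` by `q - y / t = (z - y) / t`,
where `z = q t` is the level at which the chain aims, and it has logarithmic price at least
`max (a t) (k q) ≥ h z / t`, with equality in the first place for comonotonic `(M, Q)`. Hence a unit
of length at level `y` costs at least `inf_{z > y} h z / (z - y)`. As `h` is regularly varying with
index `γ` (`infCost_monotoneRV`), this is about `κ h y / y` with
`κ = γ (γ / (γ - 1)) ^ (γ - 1)`, the optimal aim being `z = γ y / (γ - 1)`, and integrating up to `x`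
gives the total price `(κ / γ) h x`.

For the upper bound, `V = exp (c ∫ h(s) / s ds)` with `c < κ` satisfies `E V(M y + Q) ≤ V y / 2` for
large `y` (`drift_of_costPair`, from `CostPair.potential_increment_le`). Stationarity makes
`E V(R)` finite, and Markov's inequality together with Karamata's theorem gives
`IsPerpetuity.eventually_log_tail_le`.

For the lower bound, a near-optimal step is repeated on blocks `[y, (1 + δ) y]`
(`CostPair.eventually_block_le`), and the blocks are summed up
(`CostPair.eventually_le_mul_infCost`).

All functions of a real variable that occur are monotone, so regular variation is used through
elementary Potter bounds (`MonotoneRV.potter_lower`, `MonotoneRV.potter_upper`).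
-/

namespace Perpetuity

open scoped ENNReal

/-! ### Monotone regularly varying functions -/

/-- Regular variation at `+∞` with index `ρ` of a function that is monotone on `(0, ∞)`. Monotonicity
replaces measurability and the uniform convergence theorem: iterating the convergence of ratios
along a geometric grid already gives the Potter bounds. -/
structure MonotoneRV (g : ℝ → ℝ) (ρ : ℝ) : Prop where
  mono : MonotoneOn g (Set.Ioi 0)
  pos : ∀ᶠ x in atTop, 0 < g x
  ratio : ∀ t : ℝ, 0 < t → Tendsto (fun x => g (t * x) / g x) atTop (𝓝 (t ^ ρ))

namespace MonotoneRV

variable {g : ℝ → ℝ} {ρ : ℝ}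

lemma eventually_mul_le (hg : MonotoneRV g ρ) {t c : ℝ} (ht : 0 < t) (hc : c < t ^ ρ) :
    ∀ᶠ x in atTop, c * g x ≤ g (t * x) := by
  filter_upwards [hg.pos, (hg.ratio t ht).eventually_const_lt hc] with x hx h
  exact ((lt_div_iff₀ hx).1 h).le

lemma eventually_le_mul (hg : MonotoneRV g ρ) {t c : ℝ} (ht : 0 < t) (hc : t ^ ρ < c) :
    ∀ᶠ x in atTop, g (t * x) ≤ c * g x := by
  filter_upwards [hg.pos, (hg.ratio t ht).eventually_lt_const hc] with x hx h
  exact ((div_lt_iff₀ hx).1 h).le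

lemma eventually_forall_ge_pos (hg : MonotoneRV g ρ) :
    ∀ᶠ x in atTop, 0 < x ∧ ∀ y, x ≤ y → 0 < g y := by
  obtain ⟨X, hX⟩ := eventually_atTop.1 hg.pos
  filter_upwards [eventually_ge_atTop X, eventually_gt_atTop 0] with x hx hx0
  exact ⟨hx0, fun y hy => hX y (hx.trans hy)⟩

/-- The lower Potter bound. On the grid `b ^ n x` with `b ^ σ = A` the growth factor per step is at
least `A`; monotonicity fills the gaps at the price of one more factor `A`. -/
theorem potter_lower (hg : MonotoneRV g ρ) {σ A : ℝ} (hσ : 0 < σ) (hσρ : σ < ρ) (hA : 1 < A) :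
    ∀ᶠ x in atTop, ∀ t, 1 ≤ t → t ^ σ * g x ≤ A * g (t * x) := by
  set b := A ^ (1 / σ) with hb
  have hb1 : 1 < b := Real.one_lt_rpow hA (by positivity)
  have hb0 : 0 < b := by linarith
  have hbσ : b ^ σ = A := by
    rw [hb, ← Real.rpow_mul (by linarith)]; field_simp; simp
  have h1 : A < b ^ ρ := by
    rw [← hbσ]; exact Real.rpow_lt_rpow_of_exponent_lt hb1 hσρ
  obtain ⟨X, hX⟩ := eventually_atTop.1 (hg.eventually_mul_le hb0 h1)
  filter_upwards [hg.eventually_forall_ge_pos, eventually_ge_atTop X] with x hx hxX t ht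
  obtain ⟨hx0, hxp⟩ := hx
  have hiter : ∀ n : ℕ, A ^ n * g x ≤ g (b ^ n * x) := by
    intro n
    induction n with
    | zero => simp
    | succ n ih =>
      have h2 : x ≤ b ^ n * x := le_mul_of_one_le_left hx0.le (one_le_pow₀ hb1.le)
      have := hX (b ^ n * x) (hxX.trans h2)
      calc A ^ (n + 1) * g x = A * (A ^ n * g x) := by ring
        _ ≤ A * g (b ^ n * x) := by gcongr
        _ ≤ g (b * (b ^ n * x)) := this
        _ = g (b ^ (n + 1) * x) := by ring_nf
  obtain ⟨n, hn1, hn2⟩ := exists_nat_pow_near ht hb1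
  have hgx := hxp x le_rfl
  have h3 : t ^ σ ≤ A * A ^ n := by
    calc t ^ σ ≤ (b ^ (n + 1)) ^ σ := by gcongr
      _ = A * A ^ n := by
        rw [← Real.rpow_natCast, ← Real.rpow_mul hb0.le, mul_comm, Real.rpow_mul hb0.le, hbσ,
          Real.rpow_natCast]; ring
  calc t ^ σ * g x ≤ A * A ^ n * g x := by gcongr
    _ = A * (A ^ n * g x) := by ring
    _ ≤ A * g (b ^ n * x) := by gcongr; exact hiter n
    _ ≤ A * g (t * x) := by
      gcongr
      exact hg.mono (by simp; positivity) (by simp; positivity) (by gcongr)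

/-- The upper Potter bound, proved on the same grid as the lower one. -/
theorem potter_upper (hg : MonotoneRV g ρ) (hρ : 0 < ρ) {σ A : ℝ} (hσρ : ρ < σ) (hA : 1 < A) :
    ∀ᶠ x in atTop, ∀ t, 1 ≤ t → g (t * x) ≤ A * t ^ σ * g x := by
  have hσ : 0 < σ := hρ.trans hσρ
  set b := A ^ (1 / σ) with hb
  have hb1 : 1 < b := Real.one_lt_rpow hA (by positivity)
  have hb0 : 0 < b := by linarith
  have hbσ : b ^ σ = A := by
    rw [hb, ← Real.rpow_mul (by linarith)]; field_simp; simp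
  have h1 : b ^ ρ < A := by
    rw [← hbσ]; exact Real.rpow_lt_rpow_of_exponent_lt hb1 hσρ
  obtain ⟨X, hX⟩ := eventually_atTop.1 (hg.eventually_le_mul hb0 h1)
  filter_upwards [hg.eventually_forall_ge_pos, eventually_ge_atTop X] with x hx hxX t ht
  obtain ⟨hx0, hxp⟩ := hx
  have hiter : ∀ n : ℕ, g (b ^ n * x) ≤ A ^ n * g x := by
    intro n
    induction n with
    | zero => simp
    | succ n ih =>
      have h2 : x ≤ b ^ n * x := le_mul_of_one_le_left hx0.le (one_le_pow₀ hb1.le)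
      have := hX (b ^ n * x) (hxX.trans h2)
      calc g (b ^ (n + 1) * x) = g (b * (b ^ n * x)) := by ring_nf
        _ ≤ A * g (b ^ n * x) := this
        _ ≤ A * (A ^ n * g x) := by gcongr
        _ = A ^ (n + 1) * g x := by ring
  obtain ⟨n, hn1, hn2⟩ := exists_nat_pow_near ht hb1
  have hgx := hxp x le_rfl
  have h3 : A ^ n ≤ t ^ σ := by
    calc A ^ n = (b ^ n) ^ σ := by
          rw [← Real.rpow_natCast b, ← Real.rpow_mul hb0.le, mul_comm, Real.rpow_mul hb0.le, hbσ,
            Real.rpow_natCast]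
      _ ≤ t ^ σ := by gcongr
  calc g (t * x) ≤ g (b ^ (n + 1) * x) :=
        hg.mono (by simp; positivity) (by simp; positivity) (by gcongr)
    _ ≤ A ^ (n + 1) * g x := hiter _
    _ = A * A ^ n * g x := by ring
    _ ≤ A * t ^ σ * g x := by gcongr

theorem eventually_rpow_le (hg : MonotoneRV g ρ) {σ : ℝ} (hσ : 0 < σ) (hσρ : σ < ρ) (C : ℝ) :
    ∀ᶠ x in atTop, C * x ^ σ ≤ g x := by
  obtain ⟨τ, hτ1, hτ2⟩ := exists_between hσρ
  obtain ⟨x₀, ⟨hx₀, hgp⟩, hP⟩ :=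
    (hg.eventually_forall_ge_pos.and (hg.potter_lower (hσ.trans hτ1) hτ2 one_lt_two)).exists
  have hg0 := hgp x₀ le_rfl
  have hlim : Tendsto (fun x : ℝ => x ^ (τ - σ)) atTop atTop := tendsto_rpow_atTop (by linarith)
  filter_upwards [hlim.eventually_ge_atTop (C * 2 * x₀ ^ τ / g x₀), eventually_ge_atTop x₀]
    with x hx hxx
  have hx0 : 0 < x := hx₀.trans_le hxx
  have h1 := hP (x / x₀) (by rwa [le_div_iff₀ hx₀, one_mul])
  rw [div_mul_cancel₀ _ hx₀.ne', Real.div_rpow hx0.le hx₀.le] at h1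
  rw [div_le_iff₀ hg0] at hx
  have h2 : x ^ τ = x ^ (τ - σ) * x ^ σ := by rw [← Real.rpow_add hx0]; ring_nf
  have h3 : 0 < x ^ σ := by positivity
  have h4 : 0 < x₀ ^ τ := by positivity
  rw [h2] at h1
  have h5 : C * 2 * x₀ ^ τ * x ^ σ ≤ x ^ (τ - σ) * g x₀ * x ^ σ := by gcongr
  have h6 : x ^ (τ - σ) * x ^ σ / x₀ ^ τ * g x₀ = (x ^ (τ - σ) * g x₀ * x ^ σ) / x₀ ^ τ := by ring
  rw [h6, div_le_iff₀ h4] at h1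
  have h7 : (C * x ^ σ) * (2 * x₀ ^ τ) ≤ g x * (2 * x₀ ^ τ) := by linarith
  exact le_of_mul_le_mul_right h7 (by positivity)

theorem eventually_le_rpow (hg : MonotoneRV g ρ) (hρ : 0 < ρ) {σ : ℝ} (hσρ : ρ < σ) :
    ∀ᶠ x in atTop, g x ≤ x ^ σ := by
  obtain ⟨τ, hτ1, hτ2⟩ := exists_between hσρ
  obtain ⟨x₀, ⟨hx₀, hgp⟩, hP⟩ :=
    (hg.eventually_forall_ge_pos.and (hg.potter_upper hρ hτ1 one_lt_two)).exists
  have hg0 := hgp x₀ le_rfl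
  have hlim : Tendsto (fun x : ℝ => x ^ (σ - τ)) atTop atTop := tendsto_rpow_atTop (by linarith)
  filter_upwards [hlim.eventually_ge_atTop (2 * g x₀ / x₀ ^ τ), eventually_ge_atTop x₀]
    with x hx hxx
  have hx0 : 0 < x := hx₀.trans_le hxx
  have h1 := hP (x / x₀) (by rwa [le_div_iff₀ hx₀, one_mul])
  rw [div_mul_cancel₀ _ hx₀.ne', Real.div_rpow hx0.le hx₀.le] at h1
  have h2 : x ^ σ = x ^ (σ - τ) * x ^ τ := by rw [← Real.rpow_add hx0]; ring_nf
  calc g x ≤ 2 * (x ^ τ / x₀ ^ τ) * g x₀ := h1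
    _ = 2 * g x₀ / x₀ ^ τ * x ^ τ := by ring
    _ ≤ x ^ (σ - τ) * x ^ τ := by gcongr
    _ = x ^ σ := h2.symm

theorem tendsto_atTop (hg : MonotoneRV g ρ) (hρ : 0 < ρ) : Tendsto g atTop atTop := by
  have h := hg.eventually_rpow_le (half_pos hρ) (half_lt_self hρ) 1
  refine tendsto_atTop_mono' _ h ?_
  simpa using tendsto_rpow_atTop (half_pos hρ)

theorem tendsto_div_atTop (hg : MonotoneRV g ρ) (hρ : 1 < ρ) :
    Tendsto (fun x => g x / x) atTop atTop := by
  obtain ⟨σ, h1, h2⟩ := exists_between hρ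
  have h := hg.eventually_rpow_le (by linarith) h2 1
  refine tendsto_atTop_mono' _ ?_ (tendsto_rpow_atTop (sub_pos.2 h1))
  filter_upwards [h, eventually_gt_atTop 0] with x hx hx0
  rw [Real.rpow_sub_one hx0.ne', one_mul] at *
  gcongr

end MonotoneRV

/-! ### The minimal cost as a regularly varying function -/

/-- Upper bounds on the ratios suffice: the lower bound at `t` is the upper bound at `t⁻¹`. -/
theorem MonotoneRV.of_eventually_le_mul {g : ℝ → ℝ} {ρ : ℝ} (hmono : MonotoneOn g (Set.Ioi 0))
    (hpos : ∀ᶠ x in atTop, 0 < g x)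
    (hle : ∀ t : ℝ, 0 < t → ∀ c, t ^ ρ < c → ∀ᶠ x in atTop, g (t * x) ≤ c * g x) :
    MonotoneRV g ρ := by
  refine ⟨hmono, hpos, fun t ht => ?_⟩
  have hlim : Tendsto (fun x : ℝ => t * x) atTop atTop := tendsto_id.const_mul_atTop ht
  refine tendsto_order.2 ⟨fun c hc => ?_, fun c hc => ?_⟩
  · obtain ⟨c', hc1, hc2⟩ := exists_between (max_lt hc (Real.rpow_pos_of_pos ht ρ))
    have hc'0 : 0 < c' := (le_max_right _ _).trans_lt hc1
    have hinv : t⁻¹ ^ ρ < c'⁻¹ := by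
      rw [Real.inv_rpow ht.le]; exact inv_strictAnti₀ hc'0 hc2
    filter_upwards [hpos, hlim.eventually (hle t⁻¹ (by positivity) _ hinv)] with x hx h
    rw [inv_mul_cancel_left₀ ht.ne'] at h
    refine ((le_max_left _ _).trans_lt hc1).trans_le ?_
    rw [le_div_iff₀ hx]
    calc c' * g x ≤ c' * (c'⁻¹ * g (t * x)) := by gcongr
      _ = g (t * x) := by field_simp
  · obtain ⟨c', hc1, hc2⟩ := exists_between hc
    filter_upwards [hpos, hle t ht c' hc1] with x hx h
    exact ((div_le_iff₀ hx).2 h).trans_lt hc2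

/-- The function `x ↦ inf_{t ≥ 1} t * max (a t) (k (x / t))`. With `a` and `k` the logarithmic tails
of `1 / (1 - M)` and `Q` this is `h_co`: keeping `M` near `1 - 1 / t` and `Q` near `x / t` for about
`t` steps lifts the chain `R ↦ M R + Q` to the order of `x`, and `max (a t) (k (x / t))` is the
logarithmic price of one such step if `M` and `Q` are comonotonic. -/
noncomputable def infCost (a k : ℝ → ℝ) (x : ℝ) : ℝ :=
  ⨅ t : Set.Ici (1 : ℝ), (t : ℝ) * max (a t) (k (x / t))

lemma gammaIndex_eq {α r : ℝ} (hα : 1 < α) (hr : 1 < r) :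
    gammaIndex α r = α * r / (α + r - 1) := by
  have h1 : α - 1 ≠ 0 := by linarith
  have h2 : r - 1 ≠ 0 := by linarith
  have h3 : α + r - 1 ≠ 0 := by linarith
  have h4 : α / (α - 1) * (r / (r - 1)) - 1 = (α + r - 1) / ((α - 1) * (r - 1)) := by
    field_simp; ring
  unfold gammaIndex Real.conjExponent
  rw [h4]
  field_simp

lemma one_lt_gammaIndex {α r : ℝ} (hα : 1 < α) (hr : 1 < r) : 1 < gammaIndex α r := by
  rw [gammaIndex_eq hα hr, lt_div_iff₀ (by linarith)]
  nlinarith [mul_pos (sub_pos.2 hα) (sub_pos.2 hr)]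

lemma gammaIndex_lt_left {α r : ℝ} (hα : 1 < α) (hr : 1 < r) : gammaIndex α r < α := by
  rw [gammaIndex_eq hα hr, div_lt_iff₀ (by linarith)]
  nlinarith [mul_pos (by linarith : 0 < α) (sub_pos.2 hα)]

lemma gammaIndex_lt_right {α r : ℝ} (hα : 1 < α) (hr : 1 < r) : gammaIndex α r < r := by
  rw [gammaIndex_eq hα hr, div_lt_iff₀ (by linarith)]
  nlinarith [mul_pos (by linarith : 0 < r) (sub_pos.2 hr)]

section InfCost

/-- Logarithmic tails `a` of `1 / (1 - M)` and `k` of `Q`, regularly varying with indices `r - 1`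
and `α`; the shift in the first index is the factor `x` in `f(x) = -x log ℙ(M ≥ 1 - 1/x)`. -/
structure CostPair (a k : ℝ → ℝ) (α r : ℝ) : Prop where
  one_lt_left : 1 < α
  one_lt_right : 1 < r
  a_nonneg : ∀ t, 0 ≤ a t
  a_mono : Monotone a
  k_mono : Monotone k
  a_rv : MonotoneRV a (r - 1)
  k_rv : MonotoneRV k α

variable {a k : ℝ → ℝ}

lemma infCost_bddBelow (ha0 : ∀ t, 0 ≤ a t) (x : ℝ) :
    BddBelow (Set.range fun t : Set.Ici (1 : ℝ) => (t : ℝ) * max (a t) (k (x / t))) := by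
  refine ⟨0, ?_⟩
  rintro _ ⟨⟨t, ht⟩, rfl⟩
  have ht' : (1 : ℝ) ≤ t := ht
  exact mul_nonneg (by simp; linarith) (le_max_of_le_left (ha0 t))

lemma infCost_le (ha0 : ∀ t, 0 ≤ a t) (x : ℝ) {t : ℝ} (ht : 1 ≤ t) :
    infCost a k x ≤ t * max (a t) (k (x / t)) :=
  ciInf_le (infCost_bddBelow ha0 x) (⟨t, ht⟩ : Set.Ici (1 : ℝ))

lemma le_infCost {x c : ℝ} (h : ∀ t, 1 ≤ t → c ≤ t * max (a t) (k (x / t))) :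
    c ≤ infCost a k x := by
  have : Nonempty (Set.Ici (1 : ℝ)) := ⟨⟨1, Set.self_mem_Ici⟩⟩
  exact le_ciInf fun t => h t t.2

lemma exists_lt_of_infCost_lt {x c : ℝ} (h : infCost a k x < c) :
    ∃ t, 1 ≤ t ∧ t * max (a t) (k (x / t)) < c := by
  by_contra! hc
  exact absurd (le_infCost hc) (not_le.2 h)

lemma infCost_nonneg (ha0 : ∀ t, 0 ≤ a t) (x : ℝ) : 0 ≤ infCost a k x :=
  le_infCost fun t ht => mul_nonneg (by linarith) (le_max_of_le_left (ha0 t))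

lemma infCost_mono (ha0 : ∀ t, 0 ≤ a t) (hk : Monotone k) : Monotone (infCost a k) := by
  intro x y hxy
  refine le_infCost fun t ht => (infCost_le ha0 x ht).trans ?_
  have : 0 < t := by linarith
  gcongr
  exact hk (by gcongr)

variable {α r : ℝ}

/-- The choice `t = x ^ (γ / r)` balances both terms in the maximum. -/
lemma infCost_eventually_le_rpow (H : CostPair a k α r) {p : ℝ} (hp : gammaIndex α r < p) :
    ∀ᶠ x in atTop, infCost a k x ≤ x ^ p := by
  have ⟨hα, hr, ha0, _, _, ha, hk⟩ := H
  have hs1 : 0 < α + r - 1 := by linarith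
  set s := α / (α + r - 1) with hs
  have hs0 : 0 < s := by positivity
  have hs2 : s < 1 := by rw [hs, div_lt_one hs1]; linarith
  have hsγ : s * r = gammaIndex α r := by rw [gammaIndex_eq hα hr, hs]; ring
  have hsk : s + (1 - s) * α = gammaIndex α r := by
    rw [gammaIndex_eq hα hr, hs]; field_simp; ring
  have hs3 : 0 < 1 - s := by linarith
  have hp0 : 0 < p - gammaIndex α r := by linarith
  have h1 := ha.eventually_le_rpow (σ := r - 1 + (p - gammaIndex α r) / s) (by linarith)
    (by have := div_pos hp0 hs0; linarith)
  have h2 := hk.eventually_le_rpow (σ := α + (p - gammaIndex α r) / (1 - s)) (by linarith)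
    (by have := div_pos hp0 hs3; linarith)
  filter_upwards [(tendsto_rpow_atTop hs0).eventually h1, (tendsto_rpow_atTop hs3).eventually h2,
    eventually_ge_atTop 1] with x hx1 hx2 hx
  have hx0 : 0 < x := by linarith
  refine (infCost_le ha0 x (t := x ^ s) (Real.one_le_rpow hx hs0.le)).trans ?_
  have hdiv : x / x ^ s = x ^ (1 - s) := by rw [Real.rpow_sub hx0, Real.rpow_one]
  rw [hdiv, mul_max_of_nonneg _ _ (by positivity)]
  refine max_le ?_ ?_
  · calc x ^ s * a (x ^ s) ≤ x ^ s * (x ^ s) ^ (r - 1 + (p - gammaIndex α r) / s) := by gcongr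
      _ = x ^ p := by
        rw [← Real.rpow_mul hx0.le, ← Real.rpow_add hx0]
        congr 1
        rw [mul_add, mul_div_cancel₀ _ hs0.ne', ← hsγ]; ring
  · calc x ^ s * k (x ^ (1 - s))
        ≤ x ^ s * (x ^ (1 - s)) ^ (α + (p - gammaIndex α r) / (1 - s)) := by gcongr
      _ = x ^ p := by
        rw [← Real.rpow_mul hx0.le, ← Real.rpow_add hx0]
        congr 1
        rw [mul_add, mul_div_cancel₀ _ hs3.ne', ← hsk]; ring

/-- Bounded `t` costs at least about `x ^ α`, bounded `x / t` at least about `x ^ r`. Both exponents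
exceed the index `γ` of the infimum. -/
lemma eventually_rpow_le_cost (H : CostPair a k α r) {p : ℝ} (hp1 : 1 < p) (hpα : p < α)
    (hpr : p < r) {T₀ : ℝ} (hT₀ : 0 < T₀) (C : ℝ) :
    ∀ᶠ x in atTop, ∀ t, 1 ≤ t → (t ≤ T₀ ∨ x / t ≤ T₀) →
      C * x ^ p ≤ t * max (a t) (k (x / t)) := by
  have ⟨_, _, ha0, ham, hkm, ha, hk⟩ := H
  have hlim : Tendsto (fun x : ℝ => x / T₀) atTop atTop := tendsto_id.atTop_div_const hT₀
  have h1 := hlim.eventually (hk.eventually_rpow_le (by linarith) hpα (C * T₀ ^ p))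
  have h2 := hlim.eventually
    (ha.eventually_rpow_le (σ := p - 1) (by linarith) (by linarith) (C * T₀ ^ p))
  filter_upwards [h1, h2, eventually_gt_atTop 0] with x hx1 hx2 hx t ht hor
  have ht0 : 0 < t := by linarith
  have hT0p : 0 < T₀ ^ p := by positivity
  have hkey : C * T₀ ^ p * (x / T₀) ^ p = C * x ^ p := by
    rw [Real.div_rpow hx.le hT₀.le]; field_simp
  rcases hor with h | h
  · calc C * x ^ p = C * T₀ ^ p * (x / T₀) ^ p := hkey.symm
      _ ≤ k (x / T₀) := hx1
      _ ≤ k (x / t) := hkm (by gcongr)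
      _ ≤ max (a t) (k (x / t)) := le_max_right _ _
      _ ≤ t * max (a t) (k (x / t)) :=
        le_mul_of_one_le_left (le_max_of_le_left (ha0 t)) ht
  · have hxt : x / T₀ ≤ t := by rw [div_le_iff₀ hT₀]; rwa [div_le_iff₀ ht0, mul_comm] at h
    have hxT : 0 < x / T₀ := by positivity
    calc C * x ^ p = (x / T₀) * (C * T₀ ^ p * (x / T₀) ^ (p - 1)) := by
          rw [← hkey, Real.rpow_sub_one hxT.ne']; field_simp
      _ ≤ (x / T₀) * a (x / T₀) := by gcongr
      _ ≤ t * a t := by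
        gcongr
        · exact ha0 _
        · exact ham hxt
      _ ≤ t * max (a t) (k (x / t)) := by gcongr; exact le_max_left _ _

/-- Near-minimizers `t` tend to infinity together with `x / t`, so that the regular variation of both
`a` and `k` can be used at them. -/
theorem infCost_minimizers_large (H : CostPair a k α r) {T₀ : ℝ} (hT₀ : 0 < T₀) :
    ∀ᶠ x in atTop, ∀ t, 1 ≤ t → t * max (a t) (k (x / t)) ≤ 2 * infCost a k x →
      T₀ ≤ t ∧ T₀ ≤ x / t := by
  have ⟨hα, hr, _, _, _, _, _⟩ := H
  obtain ⟨p, hp1, hp2⟩ := exists_between (lt_min (gammaIndex_lt_left hα hr)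
    (gammaIndex_lt_right hα hr))
  have hp3 := (one_lt_gammaIndex hα hr).trans hp1
  filter_upwards [infCost_eventually_le_rpow H hp1,
    eventually_rpow_le_cost H hp3 (hp2.trans_le (min_le_left _ _))
      (hp2.trans_le (min_le_right _ _)) hT₀ 3, eventually_gt_atTop 0] with x hx1 hx2 hx t ht hle
  by_contra hcon
  rw [not_and_or, not_le, not_le] at hcon
  have h1 := hx2 t ht (hcon.imp le_of_lt le_of_lt)
  have : 0 < x ^ p := by positivity
  linarith

lemma infCost_eventually_pos (H : CostPair a k α r) :
    ∀ᶠ x in atTop, 0 < infCost a k x := by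
  have ⟨hα, hr, _, ham, _, ha, _⟩ := H
  obtain ⟨T₀, hT, hT₀⟩ := (ha.pos.and (eventually_gt_atTop 0)).exists
  obtain ⟨p, hp1, hp2⟩ := exists_between (lt_min hα hr)
  filter_upwards [eventually_rpow_le_cost H hp1
    (hp2.trans_le (min_le_left _ _)) (hp2.trans_le (min_le_right _ _)) hT₀ 1,
    eventually_gt_atTop 0] with x hx1 hx
  have h1 : 0 < 1 * x ^ p := by positivity
  refine (lt_min h1 (mul_pos hT₀ hT)).trans_le (le_infCost fun t ht => ?_)
  by_cases hor : t ≤ T₀ ∨ x / t ≤ T₀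
  · exact (min_le_left _ _).trans (hx1 t ht hor)
  · push Not at hor
    refine (min_le_right _ _).trans ?_
    have h3 := hor.1.le
    gcongr
    exact le_max_of_le_left (ham h3)

theorem exists_near_optimal (H : CostPair a k α r) {T₀ c : ℝ} (hT₀ : 0 < T₀) (hc : 1 < c) :
    ∀ᶠ x in atTop, ∃ t, 1 ≤ t ∧ T₀ ≤ t ∧ T₀ ≤ x / t ∧
      t * max (a t) (k (x / t)) ≤ c * infCost a k x := by
  filter_upwards [infCost_minimizers_large H hT₀,
    infCost_eventually_pos H] with x hx1 hx2
  have h1 : infCost a k x < min 2 c * infCost a k x :=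
    lt_mul_of_one_lt_left hx2 (lt_min one_lt_two hc)
  obtain ⟨t, ht, hlt⟩ := exists_lt_of_infCost_lt h1
  obtain ⟨h2, h3⟩ := hx1 t ht (hlt.le.trans (by gcongr; exact min_le_left _ _))
  exact ⟨t, ht, h2, h3, hlt.le.trans (by gcongr; exact min_le_right _ _)⟩

/-- The minimal cost has index `γ`: passing from `x` to `l x` and from `t` to `l ^ s t`, where
`s = γ / r`, multiplies `a t` and `k (x / t)` by the same power `l ^ (s (r - 1))`. -/
theorem infCost_monotoneRV (H : CostPair a k α r) :
    MonotoneRV (infCost a k) (gammaIndex α r) := by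
  have ⟨hα, hr, ha0, _, hkm, ha, hk⟩ := H
  refine MonotoneRV.of_eventually_le_mul ((infCost_mono ha0 hkm).monotoneOn _)
    (infCost_eventually_pos H) fun l hl c hc => ?_
  have hs1 : 0 < α + r - 1 := by linarith
  set s := α / (α + r - 1) with hs
  have hsγ : s + s * (r - 1) = gammaIndex α r := by rw [gammaIndex_eq hα hr, hs]; ring
  have hsk : (1 - s) * α = s * (r - 1) := by rw [hs]; field_simp; ring
  have hlγ : 0 < l ^ gammaIndex α r := by positivity
  obtain ⟨d, hd1, hd2⟩ : ∃ d : ℝ, 1 < d ∧ d * d * l ^ gammaIndex α r ≤ c := by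
    refine ⟨√(c / l ^ gammaIndex α r), ?_, ?_⟩
    · rw [Real.lt_sqrt zero_le_one, one_pow, lt_div_iff₀ hlγ]; linarith
    · rw [Real.mul_self_sqrt (by have := hlγ.trans hc; positivity), div_mul_cancel₀ _ hlγ.ne']
  -- `a` at `l ^ s t` and `k` at `l ^ (1 - s) (x / t)` grow by the same factor
  have h1 := ha.eventually_le_mul (t := l ^ s) (c := d * l ^ (s * (r - 1))) (by positivity) (by
    rw [← Real.rpow_mul hl.le]
    exact lt_mul_of_one_lt_left (by positivity) hd1)
  have h2 := hk.eventually_le_mul (t := l ^ (1 - s)) (c := d * l ^ (s * (r - 1)))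
    (by positivity) (by
    rw [← Real.rpow_mul hl.le, hsk]
    exact lt_mul_of_one_lt_left (by positivity) hd1)
  obtain ⟨T₁, hT₁⟩ := eventually_atTop.1 (h1.and h2)
  set T₀ := max (max T₁ 1) (l ^ s)⁻¹ with hT₀
  have hls : 0 < l ^ s := by positivity
  have hT₀1 : T₁ ≤ T₀ := (le_max_left _ _).trans (le_max_left _ _)
  have hT₀0 : 0 < T₀ := lt_max_of_lt_left (lt_max_of_lt_right one_pos)
  filter_upwards [exists_near_optimal H hT₀0 hd1] with x hx
  obtain ⟨t, ht, htT, hxT, hle⟩ := hx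
  have ht0 : 0 < t := by linarith
  have hlt : 1 ≤ l ^ s * t := by
    rw [← div_le_iff₀' hls, one_div]
    exact (le_max_right _ _).trans htT
  have hdiv : l * x / (l ^ s * t) = l ^ (1 - s) * (x / t) := by
    rw [Real.rpow_sub hl, Real.rpow_one]; field_simp
  calc infCost a k (l * x) ≤ l ^ s * t * max (a (l ^ s * t)) (k (l * x / (l ^ s * t))) :=
        infCost_le ha0 _ hlt
    _ ≤ l ^ s * t * (d * l ^ (s * (r - 1)) * max (a t) (k (x / t))) := by
        gcongr
        rw [hdiv, mul_max_of_nonneg _ _ (by positivity)]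
        exact max_le_max (hT₁ t (hT₀1.trans htT)).1 (hT₁ (x / t) (hT₀1.trans hxT)).2
    _ = d * (l ^ s * l ^ (s * (r - 1))) * (t * max (a t) (k (x / t))) := by ring
    _ ≤ d * (l ^ s * l ^ (s * (r - 1))) * (d * infCost a k x) := by gcongr
    _ = d * d * l ^ gammaIndex α r * infCost a k x := by
        rw [← Real.rpow_add hl, hsγ]; ring
    _ ≤ c * infCost a k x := by
        gcongr
        exact infCost_nonneg ha0 x

end InfCost

/-! ### Logarithmic tails of the marginals -/

lemma IsRegularlyVarying.eventually_pos {g : ℝ → ℝ} {ρ : ℝ} (hg : IsRegularlyVarying g ρ) :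
    ∀ᶠ x in atTop, 0 < g x := by
  obtain ⟨L, ⟨⟨A, hA, -⟩, -⟩, hgL⟩ := hg
  filter_upwards [hgL, eventually_gt_atTop A, eventually_gt_atTop 0] with x hx hxA hx0
  rw [hx]
  exact mul_pos (by positivity) (hA x hxA)

lemma IsRegularlyVarying.ratio {g : ℝ → ℝ} {ρ : ℝ} (hg : IsRegularlyVarying g ρ) {t : ℝ}
    (ht : 0 < t) : Tendsto (fun x => g (t * x) / g x) atTop (𝓝 (t ^ ρ)) := by
  obtain ⟨L, ⟨-, hL⟩, hgL⟩ := hg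
  have hlim : Tendsto (fun x : ℝ => t * x) atTop atTop := tendsto_id.const_mul_atTop ht
  have h1 := (hL t ht).const_mul (t ^ ρ)
  rw [mul_one] at h1
  refine h1.congr' ?_
  filter_upwards [hgL, hlim.eventually hgL, eventually_gt_atTop 0] with x hx htx hx0
  rw [hx, htx, Real.mul_rpow ht.le hx0.le]
  have : x ^ ρ ≠ 0 := by positivity
  rw [show t ^ ρ * x ^ ρ * L (t * x) = x ^ ρ * (t ^ ρ * L (t * x)) by ring,
    mul_div_mul_left _ _ this, mul_div_assoc]

section Tail

variable {Ω : Type*} [MeasurableSpace Ω] {P : Measure Ω}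

lemma exp_neg_kTail {X : Ω → ℝ} {x : ℝ} (hX : 0 < P.real {ω | x < X ω}) :
    Real.exp (-kTail P X x) = P.real {ω | x < X ω} := by
  rw [kTail, neg_neg, Real.exp_log hX]

lemma hco_eq_infCost {M Q : Ω → ℝ} (hT : ∀ x, 0 < P.real {ω | x < 1 / (1 - M ω)})
    (hQ : ∀ x, 0 < P.real {ω | x < Q ω}) :
    hco P M Q = infCost (kTail P fun ω => 1 / (1 - M ω)) (kTail P Q) := by
  ext x
  unfold hco infCost kTail
  congr 1
  ext t
  rw [max_neg_neg, neg_mul, mul_neg, neg_inj]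
  congr 1
  rcases le_total (P.real {ω | (t : ℝ) < 1 / (1 - M ω)}) (P.real {ω | x / (t : ℝ) < Q ω}) with h | h
  · rw [min_eq_left h, min_eq_left (Real.log_le_log (hT _) h)]
  · rw [min_eq_right h, min_eq_right (Real.log_le_log (hQ _) h)]

variable [IsProbabilityMeasure P]

lemma kTail_nonneg (X : Ω → ℝ) (x : ℝ) : 0 ≤ kTail P X x :=
  neg_nonneg.2 (Real.log_nonpos measureReal_nonneg measureReal_le_one)

lemma kTail_mono {X : Ω → ℝ} (hX : ∀ x, 0 < P.real {ω | x < X ω}) : Monotone (kTail P X) := by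
  intro x y hxy
  refine neg_le_neg (Real.log_le_log (hX y) (measureReal_mono fun ω hω => ?_))
  exact lt_of_le_of_lt hxy hω

lemma tail_pos_of_isRegularlyVarying {X : Ω → ℝ} {ρ : ℝ}
    (h : IsRegularlyVarying (kTail P X) ρ) (x : ℝ) : 0 < P.real {ω | x < X ω} := by
  obtain ⟨y, hy, hxy⟩ := (h.eventually_pos.and (eventually_ge_atTop x)).exists
  have h1 : P.real {ω | y < X ω} ≠ 0 := fun h0 => by simp [kTail, h0] at hy
  exact (measureReal_nonneg.lt_of_ne' h1).trans_le
    (measureReal_mono fun ω hω => lt_of_le_of_lt hxy hω)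

lemma monotoneRV_kTail {X : Ω → ℝ} {ρ : ℝ} (h : IsRegularlyVarying (kTail P X) ρ) :
    MonotoneRV (kTail P X) ρ :=
  ⟨(kTail_mono (tail_pos_of_isRegularlyVarying h)).monotoneOn _, h.eventually_pos,
    fun _ ht => h.ratio ht⟩

/-- Exponential moments of order `θ < 1` of the logarithmic tail `κ` of `X` at `X`. For a continuous
law `κ (X)` is a standard exponential variable; in general the integral is bounded by a sum over
the grid `b ^ n x₀`, where `b` is so close to `1` that `θ κ (b x) ≤ η κ x` for some `η < 1`. -/
theorem lintegral_exp_mul_kTail_lt_top {X : Ω → ℝ} (hXm : Measurable X) {ρ : ℝ} (hρ : 0 < ρ)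
    (hX : ∀ x, 0 < P.real {ω | x < X ω}) (hrv : MonotoneRV (kTail P X) ρ)
    {θ : ℝ} (hθ0 : 0 < θ) (hθ : θ < 1) :
    ∫⁻ ω, ENNReal.ofReal (Real.exp (θ * kTail P X (X ω))) ∂P < ∞ := by
  set κ := kTail P X with hκ
  have hmono : Monotone κ := kTail_mono hX
  obtain ⟨η, hη1, hη2⟩ := exists_between hθ
  obtain ⟨b, hb1, hb⟩ : ∃ b : ℝ, 1 < b ∧ b ^ ρ < η / θ := by
    have hq : 1 < η / θ := by rwa [one_lt_div hθ0]
    obtain ⟨q, hq1, hq2⟩ := exists_between hq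
    refine ⟨q ^ (1 / ρ), Real.one_lt_rpow hq1 (by positivity), ?_⟩
    rw [← Real.rpow_mul (by linarith), one_div_mul_cancel hρ.ne', Real.rpow_one]; exact hq2
  have hb0 : 0 < b := by linarith
  obtain ⟨x₁, hx₁⟩ := eventually_atTop.1 (hrv.eventually_le_mul hb0 hb)
  obtain ⟨x₀, ⟨hx₀, hpos⟩, hx₀₁, hpot⟩ := (hrv.eventually_forall_ge_pos.and
    ((eventually_ge_atTop x₁).and
      (hrv.potter_lower (half_pos hρ) (half_lt_self hρ) one_lt_two))).exists
  set x : ℕ → ℝ := fun n => b ^ n * x₀ with hx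
  have hxge : ∀ n, x₀ ≤ x n := fun n => le_mul_of_one_le_left hx₀.le (one_le_pow₀ hb1.le)
  have hstep : ∀ n, θ * κ (x (n + 1)) ≤ η * κ (x n) := by
    intro n
    have h1 := hx₁ (x n) (hx₀₁.trans (hxge n))
    have h2 : b * x n = x (n + 1) := by simp only [hx]; ring
    rw [h2] at h1
    calc θ * κ (x (n + 1)) ≤ θ * (η / θ * κ (x n)) := by gcongr
      _ = η * κ (x n) := by field_simp
  set s : ℝ := b ^ (ρ / 2) with hs
  have hs1 : 1 < s := Real.one_lt_rpow hb1 (half_pos hρ)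
  have hgrow : ∀ n : ℕ, (s - 1) * κ x₀ / 2 * n ≤ κ (x n) := by
    intro n
    have h1 := hpot (b ^ n) (one_le_pow₀ hb1.le)
    have h2 : ((b ^ n : ℝ)) ^ (ρ / 2) = s ^ n := by
      rw [hs, ← Real.rpow_natCast, ← Real.rpow_mul hb0.le, mul_comm, Real.rpow_mul hb0.le,
        Real.rpow_natCast]
    have h3 := one_add_mul_le_pow (a := s - 1) (by linarith) n
    rw [add_sub_cancel] at h3
    have h4 := hpos x₀ le_rfl
    rw [h2] at h1
    have h5 : (1 + n * (s - 1)) * κ x₀ ≤ s ^ n * κ x₀ := by gcongr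
    have h6 : κ (b ^ n * x₀) = κ (x n) := rfl
    rw [h6] at h1
    linarith
  set δ := (1 - η) * ((s - 1) * κ x₀ / 2) with hδ
  have hδ0 : 0 < δ := by
    have h4 := hpos x₀ le_rfl
    have h5 : 0 < 1 - η := by linarith
    have h6 : 0 < s - 1 := by linarith
    positivity
  have hsum : Summable fun n : ℕ => Real.exp (-δ) ^ n :=
    summable_geometric_of_lt_one (Real.exp_pos _).le (by rw [← Real.exp_zero]; exact Real.exp_lt_exp.2 (by linarith))
  have hterm : ∀ n : ℕ, ENNReal.ofReal (Real.exp (θ * κ (x (n + 1)))) * P {ω | x n < X ω} ≤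
      ENNReal.ofReal (Real.exp (-δ) ^ n) := by
    intro n
    rw [← ofReal_measureReal, ← exp_neg_kTail (hX _), ← ENNReal.ofReal_mul (Real.exp_pos _).le,
      ← Real.exp_add, ← Real.exp_nat_mul]
    refine ENNReal.ofReal_le_ofReal (Real.exp_le_exp.2 ?_)
    have h1 := mul_le_mul_of_nonneg_left (hgrow n) (by linarith : (0 : ℝ) ≤ 1 - η)
    have h2 := hstep n
    change _ + -κ (x n) ≤ _
    rw [hδ]
    linarith
  have hpt : ∀ ω, ENNReal.ofReal (Real.exp (θ * κ (X ω))) ≤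
      ENNReal.ofReal (Real.exp (θ * κ x₀)) + ∑' n, {ω | x n < X ω}.indicator
        (fun _ => ENNReal.ofReal (Real.exp (θ * κ (x (n + 1))))) ω := by
    intro ω
    by_cases hω : X ω ≤ x₀
    · refine le_add_right (ENNReal.ofReal_le_ofReal (Real.exp_le_exp.2 ?_))
      gcongr
      exact hmono hω
    · push Not at hω
      have h1 : 1 < X ω / x₀ := by rwa [one_lt_div hx₀]
      obtain ⟨n, hn1, hn2⟩ := exists_mem_Ioc_zpow (zero_lt_one.trans h1) hb1
      have hn0 : 0 < n + 1 := (one_lt_zpow_iff_right₀ hb1).1 (h1.trans_le hn2)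
      obtain ⟨m, rfl⟩ := Int.eq_ofNat_of_zero_le (by omega : 0 ≤ n)
      have hn2' : X ω ≤ x (m + 1) := by
        rw [div_le_iff₀ hx₀] at hn2
        exact_mod_cast hn2
      have hn1' : x m < X ω := by
        rw [lt_div_iff₀ hx₀] at hn1
        exact_mod_cast hn1
      refine le_add_left (le_trans ?_ (ENNReal.le_tsum m))
      rw [Set.indicator_of_mem (by exact hn1')]
      refine ENNReal.ofReal_le_ofReal (Real.exp_le_exp.2 ?_)
      gcongr
      exact hmono hn2'
  have hmeas : ∀ n, MeasurableSet {ω | x n < X ω} := fun n => measurableSet_lt measurable_const hXm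
  calc ∫⁻ ω, ENNReal.ofReal (Real.exp (θ * κ (X ω))) ∂P
      ≤ ∫⁻ ω, (ENNReal.ofReal (Real.exp (θ * κ x₀)) + ∑' n, {ω | x n < X ω}.indicator
        (fun _ => ENNReal.ofReal (Real.exp (θ * κ (x (n + 1))))) ω) ∂P := lintegral_mono hpt
    _ = ENNReal.ofReal (Real.exp (θ * κ x₀)) +
        ∑' n, ENNReal.ofReal (Real.exp (θ * κ (x (n + 1)))) * P {ω | x n < X ω} := by
      rw [lintegral_add_left measurable_const, lintegral_const, measure_univ, mul_one,
        lintegral_tsum fun n => (measurable_const.indicator (hmeas n)).aemeasurable]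
      congr 2
      ext n
      rw [lintegral_indicator (hmeas n), setLIntegral_const]
    _ ≤ ENNReal.ofReal (Real.exp (θ * κ x₀)) + ∑' n : ℕ, ENNReal.ofReal (Real.exp (-δ) ^ n) := by
      gcongr with n
      exact hterm n
    _ < ∞ := ENNReal.add_lt_top.2 ⟨ENNReal.ofReal_lt_top, hsum.tsum_ofReal_ne_top.lt_top⟩

/-- `-log ℙ(M ≥ 1 - 1/x)`, that is `fTail P M x / x`. It differs from `kTail P (1 / (1 - M))` only in
the weak inequality. -/
noncomputable def nearOneRate (P : Measure Ω) (M : Ω → ℝ) (x : ℝ) : ℝ :=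
  -Real.log (P.real {ω | 1 - 1 / x ≤ M ω})

lemma nearOne_pos {M : Ω → ℝ} {r : ℝ} (hf : IsRegularlyVarying (fTail P M) r) {x : ℝ}
    (hx : 0 < x) : 0 < P.real {ω | 1 - 1 / x ≤ M ω} := by
  obtain ⟨y, hy, hxy⟩ := (hf.eventually_pos.and (eventually_ge_atTop x)).exists
  have h1 : P.real {ω | 1 - 1 / y ≤ M ω} ≠ 0 := fun h0 => by rw [fTail, h0] at hy; simp at hy
  refine (measureReal_nonneg.lt_of_ne' h1).trans_le (measureReal_mono ?_)
  intro ω (hω : 1 - 1 / y ≤ M ω)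
  refine le_trans (b := 1 - 1 / y) ?_ hω
  gcongr

lemma monotoneRV_nearOneRate {M : Ω → ℝ} {r : ℝ} (hf : IsRegularlyVarying (fTail P M) r) :
    MonotoneRV (nearOneRate P M) (r - 1) := by
  have hfg : ∀ x, fTail P M x = x * nearOneRate P M x := fun x => by
    unfold fTail nearOneRate; ring
  refine ⟨fun x hx y hy hxy => ?_, ?_, fun t ht => ?_⟩
  · refine neg_le_neg (Real.log_le_log (nearOne_pos hf hy) (measureReal_mono ?_))
    intro ω (hω : 1 - 1 / y ≤ M ω)
    have : 0 < x := hx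
    refine le_trans (b := 1 - 1 / y) ?_ hω
    gcongr
  · filter_upwards [hf.eventually_pos, eventually_gt_atTop 0] with x hx hx0
    rw [hfg] at hx
    exact pos_of_mul_pos_right hx hx0.le
  · have h1 := (hf.ratio ht).div_const t
    rw [← Real.rpow_sub_one ht.ne'] at h1
    refine h1.congr' ?_
    filter_upwards [eventually_gt_atTop 0] with x hx0
    rw [hfg, hfg, mul_assoc, div_right_comm, mul_div_cancel_left₀ _ ht.ne',
      mul_div_mul_left _ _ hx0.ne']

lemma ae_lt_one {M : Ω → ℝ} {r : ℝ} (hr : 1 < r)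
    (hf : IsRegularlyVarying (fTail P M) r) : ∀ᵐ ω ∂P, M ω < 1 := by
  have hlim : Tendsto (fun x => Real.exp (-nearOneRate P M x)) atTop (𝓝 0) :=
    Real.tendsto_exp_neg_atTop_nhds_zero.comp
      ((monotoneRV_nearOneRate hf).tendsto_atTop (by linarith))
  have h0 : P.real {ω | 1 ≤ M ω} ≤ 0 := by
    refine ge_of_tendsto hlim ?_
    filter_upwards [eventually_gt_atTop 0] with x hx
    rw [nearOneRate, neg_neg, Real.exp_log (nearOne_pos hf hx)]
    refine measureReal_mono ?_
    intro ω (hω : 1 ≤ M ω)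
    have : 0 < 1 / x := by positivity
    show 1 - 1 / x ≤ M ω
    linarith
  have h1 : P {ω | 1 ≤ M ω} = 0 := by
    rw [← measureReal_eq_zero_iff]
    exact le_antisymm h0 measureReal_nonneg
  rw [ae_iff]
  simpa using h1

lemma nearOne_le_tail {M : Ω → ℝ} (hM : ∀ᵐ ω ∂P, M ω < 1) {b t : ℝ} (hb : 1 < b) (ht : 0 < t) :
    P.real {ω | 1 - 1 / (b * t) ≤ M ω} ≤ P.real {ω | t < 1 / (1 - M ω)} := by
  refine ENNReal.toReal_mono (measure_ne_top _ _) (measure_mono_ae ?_)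
  filter_upwards [hM] with ω hω h
  have h' : 1 - 1 / (b * t) ≤ M ω := h
  show t < 1 / (1 - M ω)
  rw [lt_one_div ht (by linarith)]
  refine lt_of_le_of_lt (by linarith : 1 - M ω ≤ 1 / (b * t)) ?_
  exact one_div_lt_one_div_of_lt ht (lt_mul_of_one_lt_left ht hb)

lemma tail_le_nearOne {M : Ω → ℝ} {t : ℝ} (ht : 0 < t) :
    P.real {ω | t < 1 / (1 - M ω)} ≤ P.real {ω | 1 - 1 / t ≤ M ω} := by
  refine measureReal_mono fun ω hω => ?_
  have h1 : t < 1 / (1 - M ω) := hω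
  have h2 : 0 < 1 - M ω := one_div_pos.1 (ht.trans h1)
  rw [lt_one_div ht h2] at h1
  show 1 - 1 / t ≤ M ω
  linarith

lemma tail_inv_one_sub_pos {M : Ω → ℝ} {r : ℝ} (hr : 1 < r)
    (hf : IsRegularlyVarying (fTail P M) r) (x : ℝ) : 0 < P.real {ω | x < 1 / (1 - M ω)} := by
  have h0 : 0 < max x 1 := lt_max_of_lt_right one_pos
  refine (nearOne_pos hf (by positivity : 0 < 2 * max x 1)).trans_le
    ((nearOne_le_tail (ae_lt_one hr hf) one_lt_two h0).trans (measureReal_mono ?_))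
  intro ω (hω : max x 1 < 1 / (1 - M ω))
  exact lt_of_le_of_lt (le_max_left _ _) hω

/-- The logarithmic tail of `1 / (1 - M)` lies between `nearOneRate` at `t` and at `b t` for every
`b > 1`, hence inherits its index. -/
lemma monotoneRV_kTail_inv_one_sub {M : Ω → ℝ} {r : ℝ} (hr : 1 < r)
    (hf : IsRegularlyVarying (fTail P M) r) :
    MonotoneRV (kTail P fun ω => 1 / (1 - M ω)) (r - 1) := by
  have hpos := tail_inv_one_sub_pos hr hf
  have hg := monotoneRV_nearOneRate hf
  have hle : ∀ t, 0 < t → nearOneRate P M t ≤ kTail P (fun ω => 1 / (1 - M ω)) t := fun t ht =>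
    neg_le_neg (Real.log_le_log (hpos t) (tail_le_nearOne ht))
  have hge : ∀ b t, 1 < b → 0 < t →
      kTail P (fun ω => 1 / (1 - M ω)) t ≤ nearOneRate P M (b * t) := fun b t hb ht =>
    neg_le_neg (Real.log_le_log (nearOne_pos hf (by positivity))
      (nearOne_le_tail (ae_lt_one hr hf) hb ht))
  refine MonotoneRV.of_eventually_le_mul ((kTail_mono hpos).monotoneOn _) ?_ fun t ht c hc => ?_
  · filter_upwards [hg.pos, eventually_gt_atTop 0] with x hx hx0
    exact hx.trans_le (hle x hx0)
  · have hr' : 0 < r - 1 := by linarith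
    obtain ⟨b, hb1, hb⟩ : ∃ b : ℝ, 1 < b ∧ (b * t) ^ (r - 1) < c := by
      have hcont : ContinuousAt (fun b : ℝ => (b * t) ^ (r - 1)) 1 := by
        refine ContinuousAt.rpow_const (by fun_prop) (Or.inr hr'.le)
      have hev : ∀ᶠ b in 𝓝[>] (1 : ℝ), (b * t) ^ (r - 1) < c :=
        (hcont.eventually_lt_const (by simpa using hc)).filter_mono nhdsWithin_le_nhds
      obtain ⟨b, h1, h2⟩ := (hev.and self_mem_nhdsWithin).exists
      exact ⟨b, h2, h1⟩
    have hc0 : 0 < c := lt_of_le_of_lt (by positivity) hc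
    filter_upwards [hg.eventually_le_mul (by positivity) hb, eventually_gt_atTop 0] with x hx hx0
    calc kTail P (fun ω => 1 / (1 - M ω)) (t * x) ≤ nearOneRate P M (b * (t * x)) :=
          hge b _ hb1 (by positivity)
      _ = nearOneRate P M (b * t * x) := by rw [mul_assoc]
      _ ≤ c * nearOneRate P M x := hx
      _ ≤ c * kTail P (fun ω => 1 / (1 - M ω)) x := by gcongr; exact hle x hx0

theorem costPair_of_isRegularlyVarying {M Q : Ω → ℝ} {α r : ℝ} (hα : 1 < α) (hr : 1 < r)
    (hk : IsRegularlyVarying (kTail P Q) α) (hf : IsRegularlyVarying (fTail P M) r) :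
    CostPair (kTail P fun ω => 1 / (1 - M ω)) (kTail P Q) α r where
  one_lt_left := hα
  one_lt_right := hr
  a_nonneg := kTail_nonneg _
  a_mono := kTail_mono (tail_inv_one_sub_pos hr hf)
  k_mono := kTail_mono (tail_pos_of_isRegularlyVarying hk)
  a_rv := monotoneRV_kTail_inv_one_sub hr hf
  k_rv := monotoneRV_kTail hk

/-- With `φ x = arctan (min x 0)` one has `φ R ≤ φ (M R + Q)` almost surely, with strict inequality
where `R < 0`; both sides have the same expectation. -/
theorem IsPerpetuity.ae_nonneg {M Q R : Ω → ℝ} (hR : IsPerpetuity P M Q R)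
    (hpos : ∀ᵐ ω ∂P, 0 ≤ M ω ∧ 0 ≤ Q ω) (hM1 : ∀ᵐ ω ∂P, M ω < 1) : ∀ᵐ ω ∂P, 0 ≤ R ω := by
  set φ : ℝ → ℝ := fun x => Real.arctan (min x 0) with hφ
  have hφm : Measurable φ := by fun_prop
  have hbdd : ∀ x, ‖φ x‖ ≤ Real.pi / 2 := fun x => by
    rw [Real.norm_eq_abs, abs_le]
    exact ⟨(Real.neg_pi_div_two_lt_arctan _).le, (Real.arctan_lt_pi_div_two _).le⟩
  have hid := hR.identDistrib
  have hint : ∀ X : Ω → ℝ, AEMeasurable X P → Integrable (fun ω => φ (X ω)) P := fun X hX =>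
    Integrable.of_bound (hφm.comp_aemeasurable hX).aestronglyMeasurable (Real.pi / 2)
      (Eventually.of_forall fun ω => hbdd _)
  have hle : ∀ᵐ ω ∂P, φ (R ω) ≤ φ (M ω * R ω + Q ω) := by
    filter_upwards [hpos, hM1] with ω h h1
    refine Real.arctan_mono (le_min ?_ (min_le_right _ _))
    rcases le_total 0 (R ω) with h2 | h2
    · exact (min_le_right _ _).trans (add_nonneg (mul_nonneg h.1 h2) h.2)
    · refine (min_le_left _ _).trans ?_
      nlinarith [h.1, h.2]
  have heq := (integral_eq_iff_of_ae_le (hint _ hid.aemeasurable_fst) (hint _ hid.aemeasurable_snd)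
    hle).1 (hid.comp hφm).integral_eq
  filter_upwards [hpos, hM1, heq] with ω h h1 h2
  by_contra! h3
  have h4 := Real.arctan_injective h2
  rw [min_eq_left h3.le] at h4
  have h5 : R ω < M ω * R ω + Q ω := by nlinarith [h.1, h.2]
  have := lt_min h5 h3
  linarith

end Tail

/-! ### The sharp constant and the potential -/

/-- The minimum of `l ^ p / (l - 1)` over `l > 1`, attained at `l = p / (p - 1)`. It is `p` times the
constant `(p / (p - 1)) ^ (p - 1)`. -/
noncomputable def sharpRate (p : ℝ) : ℝ := p * (p / (p - 1)) ^ (p - 1)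

lemma sharpRate_pos {p : ℝ} (hp : 1 < p) : 0 < sharpRate p := by
  have : 0 < p - 1 := by linarith
  unfold sharpRate
  positivity

lemma sharpRate_mul_sub_one {p : ℝ} (hp : 1 < p) :
    sharpRate p * (p / (p - 1) - 1) = (p / (p - 1)) ^ p := by
  have h1 : 0 < p - 1 := by linarith
  have hq : 0 < p / (p - 1) := by positivity
  have h2 : (p / (p - 1)) ^ p = (p / (p - 1)) ^ (p - 1) * (p / (p - 1)) := by
    rw [← Real.rpow_add_one hq.ne']; ring_nf
  rw [h2, sharpRate]
  field_simp
  ring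

/-- Bernoulli's inequality, written around the minimizer `p / (p - 1)`. -/
lemma sharpRate_mul_le {p : ℝ} (hp : 1 < p) {l : ℝ} (hl : 0 ≤ l) :
    sharpRate p * (l - 1) ≤ l ^ p := by
  have h1 : 0 < p - 1 := by linarith
  have hq : 0 < p / (p - 1) := by positivity
  set q := p / (p - 1) with hqd
  have hB := one_add_mul_self_le_rpow_one_add (s := l / q - 1)
    (by have : 0 ≤ l / q := by positivity
        linarith) hp.le
  have h3 : l ^ p = q ^ p * (1 + (l / q - 1)) ^ p := by
    rw [add_sub_cancel, ← Real.mul_rpow hq.le (by positivity), mul_div_cancel₀ _ hq.ne']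
  rw [h3]
  refine le_trans (le_of_eq ?_) (mul_le_mul_of_nonneg_left hB (by positivity))
  rw [← sharpRate_mul_sub_one hp, ← hqd]
  have h4 : (q - 1) * (1 + p * (l / q - 1)) = l - 1 := by
    rw [hqd]; field_simp; ring
  rw [mul_assoc, h4]

lemma continuousAt_sharpRate {p : ℝ} (hp : 1 < p) : ContinuousAt sharpRate p := by
  have h1 : p - 1 ≠ 0 := by linarith
  have h2 : 0 < p - 1 := by linarith
  unfold sharpRate
  refine continuousAt_id.mul (ContinuousAt.rpow ?_ (by fun_prop) (Or.inl (by positivity)))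
  exact continuousAt_id.div (by fun_prop) h1

namespace MonotoneRV

variable {g : ℝ → ℝ} {ρ : ℝ}

/-- The chain at level `y` that aims at level `z` pays `g z / (z - y)` per unit of length. The cheapest
aim `z > y` costs about `sharpRate ρ * g y / y`, uniformly in `z` by the Potter bounds. -/
theorem eventually_mul_sub_mul_le (hg : MonotoneRV g ρ) (hρ : 1 < ρ) {c : ℝ}
    (hc : c < sharpRate ρ) : ∀ᶠ y in atTop, ∀ z, y ≤ z → c * (z - y) * g y ≤ y * g z := by
  obtain ⟨c', hcc, hc'⟩ := exists_between (max_lt hc (sharpRate_pos hρ))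
  have hc'0 : 0 < c' := (le_max_right _ _).trans_lt hcc
  have hc'c : c ≤ c' := (le_max_left _ _).trans hcc.le
  obtain ⟨σ, ⟨hσ1, hσ2⟩, hσ3⟩ : ∃ σ, (c' < sharpRate σ ∧ 1 < σ) ∧ σ < ρ := by
    have h1 := ((continuousAt_sharpRate hρ).eventually_const_lt hc').and
      (eventually_gt_nhds hρ)
    exact ((h1.filter_mono nhdsWithin_le_nhds).and
      (self_mem_nhdsWithin : ∀ᶠ σ in 𝓝[<] ρ, σ < ρ)).exists
  have hσ0 := sharpRate_pos hσ2
  filter_upwards [hg.potter_lower (by linarith) hσ3 ((one_lt_div hc'0).2 hσ1),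
    hg.eventually_forall_ge_pos] with y hy hpos z hz
  obtain ⟨hy0, hgy⟩ := hpos
  have hgy0 := hgy y le_rfl
  have h1 := hy (z / y) (by rwa [le_div_iff₀ hy0, one_mul])
  rw [div_mul_cancel₀ _ hy0.ne'] at h1
  have h2 := sharpRate_mul_le hσ2 (l := z / y) (by have := hy0.trans_le hz; positivity)
  have h3 : sharpRate σ * (z / y - 1) * g y ≤ sharpRate σ / c' * g z :=
    (mul_le_mul_of_nonneg_right h2 hgy0.le).trans h1
  have h4 : c' * ((z - y) * g y) ≤ y * g z := by
    have h5 := mul_le_mul_of_nonneg_left h3 (by positivity : 0 ≤ c' / sharpRate σ * y)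
    have e1 : c' / sharpRate σ * y * (sharpRate σ * (z / y - 1) * g y) =
        c' * ((z - y) * g y) := by field_simp
    have e2 : c' / sharpRate σ * y * (sharpRate σ / c' * g z) = y * g z := by field_simp
    rwa [e1, e2] at h5
  calc c * (z - y) * g y = c * ((z - y) * g y) := by ring
    _ ≤ c' * ((z - y) * g y) := by
      have := mul_nonneg (sub_nonneg.2 hz) hgy0.le
      gcongr
    _ ≤ y * g z := h4

end MonotoneRV

/-- `c ∫_1^y g(s) / s ds` for `y ≥ 1`, and `0` for `y ≤ 1`. For `g` of index `ρ` it is equivalent to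
`(c / ρ) g`, but unlike `g` its increments are under control. -/
noncomputable def potential (g : ℝ → ℝ) (c y : ℝ) : ℝ := c * ∫ s in (1)..(max y 1), g s / s

section Potential

variable {g : ℝ → ℝ} {c : ℝ}

lemma intervalIntegrable_div_self (hg : MonotoneOn g (Set.Ioi 0)) {u v : ℝ} (hu : 0 < u)
    (hv : 0 < v) : IntervalIntegrable (fun s => g s / s) volume u v := by
  have hsub : Set.uIcc u v ⊆ Set.Ioi 0 := fun s hs => (lt_min hu hv).trans_le hs.1
  simp only [div_eq_mul_inv]
  refine (hg.mono hsub).intervalIntegrable.mul_continuousOn ?_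
  exact continuousOn_id.inv₀ fun s hs => (hsub hs).ne'

lemma potential_sub (hg : MonotoneOn g (Set.Ioi 0)) {u v : ℝ} (hu : 1 ≤ u) (hv : 1 ≤ v) :
    potential g c v - potential g c u = c * ∫ s in u..v, g s / s := by
  rw [potential, potential, max_eq_left hu, max_eq_left hv, ← mul_sub,
    intervalIntegral.integral_interval_sub_left
      (intervalIntegrable_div_self hg one_pos (by linarith))
      (intervalIntegrable_div_self hg one_pos (by linarith))]

lemma potential_sub_le (hg : MonotoneOn g (Set.Ioi 0)) (hg0 : ∀ x, 0 ≤ g x) (hc : 0 ≤ c)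
    {u v : ℝ} (hu : 1 ≤ u) (huv : u ≤ v) :
    potential g c v - potential g c u ≤ c * ((v - u) * (g v / u)) := by
  rw [potential_sub hg hu (hu.trans huv)]
  refine mul_le_mul_of_nonneg_left ?_ hc
  have h := intervalIntegral.integral_mono_on huv
    (intervalIntegrable_div_self hg (by linarith) (by linarith))
    (intervalIntegrable_const (c := g v / u) (μ := volume)) fun s hs => by
      have hs0 : 0 < s := by linarith [hs.1]
      have := hg0 v
      exact div_le_div₀ this (hg hs0 (by simp; linarith) hs.2) (by linarith) hs.1
  rwa [intervalIntegral.integral_const, smul_eq_mul] at h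

lemma le_potential_sub (hg : MonotoneOn g (Set.Ioi 0)) (hg0 : ∀ x, 0 ≤ g x) (hc : 0 ≤ c)
    {u v : ℝ} (hu : 1 ≤ u) (huv : u ≤ v) :
    c * ((v - u) * (g u / v)) ≤ potential g c v - potential g c u := by
  rw [potential_sub hg hu (hu.trans huv)]
  refine mul_le_mul_of_nonneg_left ?_ hc
  have h := intervalIntegral.integral_mono_on huv
    (intervalIntegrable_const (c := g u / v) (μ := volume))
    (intervalIntegrable_div_self hg (by linarith) (by linarith)) fun s hs => by
      have hs0 : 0 < s := by linarith [hs.1]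
      exact div_le_div₀ (hg0 s) (hg (by simp; linarith) hs0 hs.1) hs0 hs.2
  rwa [intervalIntegral.integral_const, smul_eq_mul] at h

lemma potential_mono (hg : MonotoneOn g (Set.Ioi 0)) (hg0 : ∀ x, 0 ≤ g x) (hc : 0 ≤ c) :
    Monotone (potential g c) := by
  intro u v huv
  have h1 : ∀ x, potential g c x = potential g c (max x 1) := fun x => by
    simp [potential]
  rw [h1 u, h1 v]
  have hle : max u 1 ≤ max v 1 := max_le_max huv le_rfl
  have h2 := le_potential_sub hg hg0 hc (le_max_right u 1) hle
  have h3 : 0 ≤ c * ((max v 1 - max u 1) * (g (max u 1) / max v 1)) := by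
    have : 0 ≤ max v 1 - max u 1 := by linarith
    have h4 := hg0 (max u 1)
    have h5 : 0 ≤ max v 1 := zero_le_one.trans (le_max_right _ _)
    positivity
  linarith

lemma potential_nonneg (hg : MonotoneOn g (Set.Ioi 0)) (hg0 : ∀ x, 0 ≤ g x) (hc : 0 ≤ c) (x : ℝ) :
    0 ≤ potential g c x := by
  have h : potential g c (min x 1) = 0 := by simp [potential]
  rw [← h]
  exact potential_mono hg hg0 hc (min_le_left _ _)

namespace MonotoneRV

variable {ρ : ℝ}

theorem potential_eventually_le_rpow (hg : MonotoneRV g ρ) (hc : 0 ≤ c) (hρ : 0 < ρ) {σ : ℝ}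
    (hσ : ρ < σ) : ∀ᶠ y in atTop, potential g c y ≤ y ^ σ := by
  obtain ⟨τ, hτ1, hτ2⟩ := exists_between hσ
  have hτ0 : 0 < τ := hρ.trans hτ1
  obtain ⟨x₁, hx₁⟩ := eventually_atTop.1 (hg.eventually_le_rpow hρ hτ1)
  set x₀ := max x₁ 1 with hx₀
  have hx₀1 : 1 ≤ x₀ := le_max_right _ _
  set C := potential g c x₀
  have hlim : Tendsto (fun x : ℝ => x ^ (σ - τ)) atTop atTop := tendsto_rpow_atTop (by linarith)
  filter_upwards [hlim.eventually_ge_atTop (|C| + c / τ), eventually_ge_atTop x₀] with y hy hxy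
  have hy1 : 1 ≤ y := hx₀1.trans hxy
  have hy0 : 0 < y := by linarith
  have h1 := potential_sub (c := c) hg.mono hx₀1 hy1
  have h2 : ∫ s in x₀..y, g s / s ≤ ∫ s in x₀..y, s ^ (τ - 1) := by
    refine intervalIntegral.integral_mono_on hxy
      (intervalIntegrable_div_self hg.mono (by linarith) hy0)
      (intervalIntegral.intervalIntegrable_rpow' (by linarith)) fun s hs => ?_
    have hs0 : 0 < s := by linarith [hs.1]
    rw [Real.rpow_sub_one hs0.ne']
    gcongr
    exact hx₁ s ((le_max_left _ _).trans hs.1)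
  rw [integral_rpow (Or.inl (by linarith)), sub_add_cancel] at h2
  have h3 : (y ^ τ - x₀ ^ τ) / τ ≤ y ^ τ / τ := by
    have : 0 ≤ x₀ ^ τ := by positivity
    gcongr
    linarith
  have h4 : c * ∫ s in x₀..y, g s / s ≤ c * (y ^ τ / τ) :=
    mul_le_mul_of_nonneg_left (h2.trans h3) hc
  have h5 : 1 ≤ y ^ τ := Real.one_le_rpow hy1 hτ0.le
  have h6 : y ^ σ = y ^ (σ - τ) * y ^ τ := by rw [← Real.rpow_add hy0]; ring_nf
  rw [h6]
  have h7 : (|C| + c / τ) * y ^ τ ≤ y ^ (σ - τ) * y ^ τ := by gcongr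
  have h8 : |C| ≤ |C| * y ^ τ := le_mul_of_one_le_right (abs_nonneg _) h5
  have h9 := le_abs_self C
  have h10 : c * (y ^ τ / τ) = c / τ * y ^ τ := by ring
  linarith

/-- The lower half of Karamata's theorem for `∫ g(s) / s ds`, by integrating the upper Potter bound
`g y ≤ A (y / s) ^ σ g s` in `s`. -/
theorem eventually_mul_le_potential (hg : MonotoneRV g ρ) (hg0 : ∀ x, 0 ≤ g x) (hρ : 0 < ρ)
    (hc : 0 < c) {c' : ℝ} (hc' : c' < c / ρ) : ∀ᶠ y in atTop, c' * g y ≤ potential g c y := by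
  obtain ⟨d, hdd, hd2⟩ := exists_between (max_lt hc' (div_pos hc hρ))
  have hd0 : 0 < d := (le_max_right _ _).trans_lt hdd
  have hd1 : c' ≤ d := (le_max_left _ _).trans hdd.le
  obtain ⟨e, he1, he2⟩ := exists_between hd2
  have he0 : 0 < e := hd0.trans he1
  obtain ⟨f, hf1, hf2⟩ := exists_between he2
  have hf0 : 0 < f := he0.trans hf1
  -- exponents and constants with `c / σ = f`
  have hσ : ρ < c / f := by rwa [lt_div_iff₀ hf0, ← lt_div_iff₀' hρ]
  set σ := c / f with hσd
  have hσ0 : 0 < σ := hρ.trans hσ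
  obtain ⟨X, hX⟩ := eventually_atTop.1 (hg.potter_upper hρ hσ ((one_lt_div he0).2 hf1))
  obtain ⟨x₁, hx₁X, hx₁⟩ : ∃ x₁, X ≤ x₁ ∧ 1 ≤ x₁ := ⟨max X 1, le_max_left _ _, le_max_right _ _⟩
  have hlim : Tendsto (fun y : ℝ => 1 - (x₁ / y) ^ σ) atTop (𝓝 1) := by
    have h1 : Tendsto (fun y : ℝ => x₁ / y) atTop (𝓝 0) := tendsto_const_nhds.div_atTop tendsto_id
    have h2 := h1.rpow_const (p := σ) (Or.inr hσ0.le)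
    rw [Real.zero_rpow hσ0.ne'] at h2
    simpa using h2.const_sub 1
  filter_upwards [hlim.eventually_const_lt ((div_lt_one he0).2 he1), eventually_ge_atTop x₁]
    with y hy hxy
  have hy1 : 1 ≤ y := hx₁.trans hxy
  have hy0 : 0 < y := by linarith
  have h1 := potential_sub (c := c) hg.mono hx₁ hy1
  have h2 : ∫ s in x₁..y, (e / f * g y / y ^ σ) * s ^ (σ - 1) ≤ ∫ s in x₁..y, g s / s := by
    refine intervalIntegral.integral_mono_on hxy
      ((intervalIntegral.intervalIntegrable_rpow' (by linarith)).const_mul _)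
      (intervalIntegrable_div_self hg.mono (by linarith) hy0) fun s hs => ?_
    have hs0 : 0 < s := by linarith [hs.1]
    have h3 := hX s (hx₁X.trans hs.1) (y / s) (by rw [le_div_iff₀ hs0, one_mul]; exact hs.2)
    rw [div_mul_cancel₀ _ hs0.ne', Real.div_rpow hy0.le hs0.le] at h3
    rw [Real.rpow_sub_one hs0.ne', le_div_iff₀ hs0]
    have h4 : 0 < s ^ σ := by positivity
    have h5 : 0 < y ^ σ := by positivity
    calc e / f * g y / y ^ σ * (s ^ σ / s) * s = e / f * s ^ σ / y ^ σ * g y := by field_simp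
      _ ≤ e / f * s ^ σ / y ^ σ * (f / e * (y ^ σ / s ^ σ) * g s) := by gcongr
      _ = g s := by field_simp
  rw [intervalIntegral.integral_const_mul, integral_rpow (Or.inl (by linarith)),
    sub_add_cancel] at h2
  have hyσ : 0 < y ^ σ := by positivity
  rw [Real.div_rpow (by linarith) hy0.le] at hy
  have h6 : e / f * g y / y ^ σ * ((y ^ σ - x₁ ^ σ) / σ) =
      (1 - x₁ ^ σ / y ^ σ) * (e * g y / c) := by
    rw [hσd]; field_simp
  rw [h6] at h2
  have h7 : d * g y ≤ c * ∫ s in x₁..y, g s / s := by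
    calc d * g y = c * (d / e * (e * g y / c)) := by field_simp
      _ ≤ c * ((1 - x₁ ^ σ / y ^ σ) * (e * g y / c)) := by
        have := hg0 y
        gcongr
      _ ≤ _ := by gcongr
  have h8 := potential_nonneg hg.mono hg0 hc.le x₁
  have h9 : c' * g y ≤ d * g y := mul_le_mul_of_nonneg_right hd1 (hg0 y)
  linarith

end MonotoneRV

end Potential

/-- One upward step `y ↦ (1 - 1/t) y + q` gains in the potential at most a fraction `θ < 1` of its
logarithmic price `max (a t) (k q)`. Steps shorter than `δ y` are treated with
`MonotoneRV.eventually_mul_sub_mul_le` for the aim `z = q t`; longer ones need `q ≥ δ y`, and then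
`k q` alone outweighs the whole potential. -/
theorem CostPair.potential_increment_le {a k : ℝ → ℝ} {α r : ℝ} (H : CostPair a k α r) {c : ℝ}
    (hc0 : 0 < c) (hc : c < sharpRate (gammaIndex α r)) :
    ∃ θ, 0 < θ ∧ θ < 1 ∧ ∀ᶠ y in atTop, ∀ t q, 1 ≤ t → 0 ≤ q → 0 < q - y / t →
      potential (infCost a k) c (y + (q - y / t)) - potential (infCost a k) c y ≤
        θ * max (a t) (k q) := by
  set γ := gammaIndex α r with hγ
  set h := infCost a k with hh
  have hγ1 : 1 < γ := one_lt_gammaIndex H.one_lt_left H.one_lt_right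
  have hrv : MonotoneRV h γ := infCost_monotoneRV H
  have h0 : ∀ x, 0 ≤ h x := infCost_nonneg H.a_nonneg
  obtain ⟨c₁, hc1, hc1'⟩ := exists_between hc
  obtain ⟨c₂, hc2, hc2'⟩ := exists_between hc1'
  have hc10 : 0 < c₁ := hc0.trans hc1
  have hc20 : 0 < c₂ := hc10.trans hc2
  obtain ⟨δ, hδ0, hδ⟩ : ∃ δ : ℝ, 0 < δ ∧ (1 + δ) ^ γ < c₁ / c := by
    have hcont : ContinuousAt (fun δ : ℝ => (1 + δ) ^ γ) 0 :=
      ContinuousAt.rpow_const (by fun_prop) (Or.inr (by linarith))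
    have hev : ∀ᶠ δ in 𝓝[>] (0 : ℝ), (1 + δ) ^ γ < c₁ / c :=
      (hcont.eventually_lt_const (by simpa using (one_lt_div hc0).2 hc1)).filter_mono
        nhdsWithin_le_nhds
    obtain ⟨δ, h1, h2⟩ := (hev.and self_mem_nhdsWithin).exists
    exact ⟨δ, h2, h1⟩
  obtain ⟨p, hp1, hp2⟩ := exists_between (gammaIndex_lt_left H.one_lt_left H.one_lt_right)
  set θ := c₁ / c₂ with hθ
  have hθ0 : 0 < θ := by positivity
  set D := 1 / δ + 1 with hD
  have hD0 : 0 < D := by positivity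
  have hlimD : Tendsto (fun q : ℝ => D * q) atTop atTop := tendsto_id.const_mul_atTop hD0
  have hlimδ : Tendsto (fun q : ℝ => δ * q) atTop atTop := tendsto_id.const_mul_atTop hδ0
  -- a single large value of `Q` is more expensive than the gain in the potential, as `γ < α`
  have hbig : ∀ᶠ q in atTop, potential h c (D * q) ≤ θ * k q := by
    filter_upwards [hlimD.eventually (hrv.potential_eventually_le_rpow hc0.le (by linarith) hp1),
      H.k_rv.eventually_rpow_le (by linarith) hp2 (D ^ p / θ), eventually_gt_atTop 0]
      with q hq1 hq2 hq
    refine hq1.trans ?_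
    rw [Real.mul_rpow hD0.le hq.le]
    calc D ^ p * q ^ p = θ * (D ^ p / θ * q ^ p) := by field_simp
      _ ≤ θ * k q := by gcongr
  obtain ⟨q₀, hq₀⟩ := eventually_atTop.1 hbig
  refine ⟨θ, hθ0, (div_lt_one hc20).2 hc2, ?_⟩
  filter_upwards [hrv.eventually_le_mul (by linarith) hδ, hrv.eventually_mul_sub_mul_le hγ1 hc2',
    hlimδ.eventually_ge_atTop q₀, eventually_ge_atTop 1] with y hy1 hy2 hy3 hy t q ht hq hd
  have hy0 : 0 < y := by linarith
  have ht0 : 0 < t := by linarith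
  have hyt : 0 < y / t := by positivity
  rcases le_total (δ * y) (q - y / t) with hcase | hcase
  · have hqy : δ * y ≤ q := by linarith
    have h1 : y + (q - y / t) ≤ D * q := by
      have h2 : y ≤ 1 / δ * q := by rw [one_div_mul_eq_div, le_div_iff₀ hδ0]; linarith
      rw [hD, add_mul, one_mul]; linarith
    have h3 := potential_mono hrv.mono h0 hc0.le h1
    have h4 := hq₀ q (hy3.trans hqy)
    have h5 := potential_nonneg hrv.mono h0 hc0.le y
    have h6 : θ * k q ≤ θ * max (a t) (k q) := by gcongr; exact le_max_right _ _
    linarith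
  · have hdt : t * (q - y / t) = q * t - y := by field_simp
    have hz : y ≤ q * t := by
      have := mul_pos ht0 hd
      linarith
    have hzt : q * t / t = q := by field_simp
    have hcost := infCost_le (k := k) H.a_nonneg (q * t) ht
    rw [hzt] at hcost
    calc potential h c (y + (q - y / t)) - potential h c y
        ≤ c * ((y + (q - y / t) - y) * (h (y + (q - y / t)) / y)) :=
          potential_sub_le hrv.mono h0 hc0.le hy (by linarith)
      _ ≤ c * ((q - y / t) * ((c₁ / c * h y) / y)) := by
          rw [add_sub_cancel_left]
          gcongr
          exact (hrv.mono (by simp; linarith) (by simp; positivity) (by linarith)).trans hy1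
      _ = θ / (t * y) * (c₂ * (q * t - y) * h y) := by
          rw [← hdt, hθ]; field_simp
      _ ≤ θ / (t * y) * (y * h (q * t)) := mul_le_mul_of_nonneg_left (hy2 _ hz) (by positivity)
      _ ≤ θ / (t * y) * (y * (t * max (a t) (k q))) := by gcongr
      _ = θ * max (a t) (k q) := by field_simp

section UpperBound

variable {Ω : Type*} [MeasurableSpace Ω] {P : Measure Ω}

/-! ### The upper bound by a drift condition -/

/-- If `v` is stationary for a kernel that maps it below `v / 2 + K`, then `∫ v / 2 ≤ K`, without
assuming that `v` is integrable: stationarity is only used for the truncations `min v N`. -/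
theorem lintegral_le_of_truncated_drift [IsProbabilityMeasure P] {v : Ω → ℝ≥0∞}
    (hv : Measurable v) (hfin : ∀ ω, v ω ≠ ∞) {K : ℝ≥0∞}
    (h : ∀ N : ℕ, ∫⁻ ω, min (v ω) N ∂P ≤ ∫⁻ ω, min (v ω / 2 + K) N ∂P) :
    ∫⁻ ω, v ω / 2 ∂P ≤ K := by
  have hN : ∀ N : ℕ, ∫⁻ ω, {ω | v ω ≤ N}.indicator (fun ω => v ω / 2) ω ∂P ≤ K := by
    intro N
    have hfinN : ∫⁻ ω, min (v ω / 2 + K) (N : ℝ≥0∞) ∂P ≠ ∞ := by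
      refine ne_top_of_le_ne_top (ENNReal.natCast_ne_top N) ?_
      calc ∫⁻ ω, min (v ω / 2 + K) (N : ℝ≥0∞) ∂P ≤ ∫⁻ _, (N : ℝ≥0∞) ∂P :=
            lintegral_mono fun ω => min_le_right _ _
        _ = N := by simp
    -- where `v > N` both truncations are at most `N` and contribute nothing
    have hpt : ∀ ω, {ω | v ω ≤ N}.indicator (fun ω => v ω / 2) ω + min (v ω / 2 + K) N ≤
        min (v ω) N + K := by
      intro ω
      by_cases hω : v ω ≤ N
      · rw [Set.indicator_of_mem (by exact hω), min_eq_left hω]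
        calc v ω / 2 + min (v ω / 2 + K) N ≤ v ω / 2 + (v ω / 2 + K) := by
              gcongr; exact min_le_left _ _
          _ = v ω + K := by rw [← add_assoc, ENNReal.add_halves]
      · rw [Set.indicator_of_notMem (by exact hω), zero_add, min_eq_right (not_le.1 hω).le]
        exact (min_le_right _ _).trans le_self_add
    have h1 : ∫⁻ ω, {ω | v ω ≤ N}.indicator (fun ω => v ω / 2) ω ∂P +
        ∫⁻ ω, min (v ω / 2 + K) N ∂P ≤ K + ∫⁻ ω, min (v ω / 2 + K) N ∂P := by
      rw [← lintegral_add_right _ (by fun_prop)]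
      calc _ ≤ ∫⁻ ω, (min (v ω) N + K) ∂P := lintegral_mono hpt
        _ = ∫⁻ ω, min (v ω) N ∂P + K := by
          rw [lintegral_add_right _ measurable_const]; simp
        _ ≤ K + ∫⁻ ω, min (v ω / 2 + K) N ∂P := by rw [add_comm]; exact add_le_add le_rfl (h N)
    exact (ENNReal.add_le_add_iff_right hfinN).1 h1
  have hsup : ∀ ω, v ω / 2 = ⨆ N : ℕ, {ω | v ω ≤ N}.indicator (fun ω => v ω / 2) ω := by
    intro ω
    refine le_antisymm ?_ (iSup_le fun N => Set.indicator_le_self _ _ _)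
    obtain ⟨N, hN⟩ := ENNReal.exists_nat_gt (hfin ω)
    refine le_iSup_of_le N ?_
    rw [Set.indicator_of_mem (by exact hN.le)]
  rw [lintegral_congr hsup, lintegral_iSup]
  · exact iSup_le hN
  · exact fun N => (hv.div_const 2).indicator (measurableSet_le hv measurable_const)
  · intro m n hmn ω
    refine Set.indicator_le_indicator_of_subset (fun ω' h' => ?_) (fun _ => zero_le) ω
    have h'' : v ω' ≤ m := h'
    show v ω' ≤ n
    exact h''.trans (by exact_mod_cast hmn)

lemma IsPerpetuity.lintegral_eq [IsProbabilityMeasure P] {M Q R : Ω → ℝ}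
    (hR : IsPerpetuity P M Q R) (hM : Measurable M) (hQ : Measurable Q) {F : ℝ → ℝ≥0∞}
    (hF : Measurable F) :
    ∫⁻ ω, F (R ω) ∂P = ∫⁻ ω', ∫⁻ ω, F (M ω * R ω' + Q ω) ∂P ∂P := by
  have hMQ : Measurable fun ω => (M ω, Q ω) := hM.prodMk hQ
  have h1 : ∫⁻ ω, F (R ω) ∂P = ∫⁻ ω, F (M ω * R ω + Q ω) ∂P :=
    (hR.identDistrib.comp hF).lintegral_eq
  have hG : Measurable fun z : (ℝ × ℝ) × ℝ => F (z.1.1 * z.2 + z.1.2) := by fun_prop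
  have h2 := (indepFun_iff_map_prod_eq_prod_map_map hMQ.aemeasurable
    hR.measurable.aemeasurable).1 hR.indep
  have h3 : ∫⁻ ω, F (M ω * R ω + Q ω) ∂P =
      ∫⁻ z, F (z.1.1 * z.2 + z.1.2) ∂(P.map fun ω => ((M ω, Q ω), R ω)) :=
    (lintegral_map hG (hMQ.prodMk hR.measurable)).symm
  have : IsProbabilityMeasure (P.map R) := Measure.isProbabilityMeasure_map
    hR.measurable.aemeasurable
  have : IsProbabilityMeasure (P.map fun ω => (M ω, Q ω)) := Measure.isProbabilityMeasure_map
    hMQ.aemeasurable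
  rw [h1, h3, h2, lintegral_prod_symm' _ hG, lintegral_map hG.lintegral_prod_left' hR.measurable]
  refine lintegral_congr fun ω' => ?_
  rw [lintegral_map (by fun_prop) hMQ]

/-- Since `R` has the law of `M R + Q ≥ Q`, its tail is positive, so that no logarithm of `0` enters
the quotient in the theorem. -/
lemma IsPerpetuity.tail_le [IsProbabilityMeasure P] {M Q R : Ω → ℝ} (hR : IsPerpetuity P M Q R)
    (hpos : ∀ᵐ ω ∂P, 0 ≤ M ω ∧ 0 ≤ Q ω) (hR0 : ∀ᵐ ω ∂P, 0 ≤ R ω) (x : ℝ) :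
    P.real {ω | x < Q ω} ≤ P.real {ω | x < R ω} := by
  have h1 : P {ω | x < R ω} = P {ω | x < M ω * R ω + Q ω} :=
    hR.identDistrib.measure_mem_eq measurableSet_Ioi
  refine ENNReal.toReal_mono (measure_ne_top _ _) ?_
  rw [h1]
  refine measure_mono_ae ?_
  filter_upwards [hpos, hR0] with ω h h0 hx
  have hx' : x < Q ω := hx
  show x < M ω * R ω + Q ω
  have := mul_nonneg h.1 h0
  linarith

section Drift

variable {M Q : Ω → ℝ} {α r : ℝ}

/-- The drift condition for `V = exp (potential h c)`. Either the chain falls by at least `1`, which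
divides `V` by `4`, or `V` grows by a factor of at most `exp (θ W)`, where `W` is the price of the
step; in the latter case `W` is at least `s y → ∞`, while `exp (η W)` is integrable for some
`η > θ`. No assumption on the dependence between `M` and `Q` is needed, since the moment of the
maximum `W` is bounded by the sum of the two marginal moments. -/
theorem drift_of_costPair [IsProbabilityMeasure P] (hM : Measurable M) (hQ : Measurable Q)
    (hpos : ∀ᵐ ω ∂P, 0 ≤ M ω ∧ 0 ≤ Q ω) (hM1 : ∀ᵐ ω ∂P, M ω < 1)
    (hTpos : ∀ x, 0 < P.real {ω | x < 1 / (1 - M ω)}) (hQpos : ∀ x, 0 < P.real {ω | x < Q ω})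
    (H : CostPair (kTail P fun ω => 1 / (1 - M ω)) (kTail P Q) α r) {c : ℝ} (hc0 : 0 < c)
    (hc : c < sharpRate (gammaIndex α r)) :
    ∀ᶠ y in atTop,
      ∫⁻ ω, ENNReal.ofReal (Real.exp (potential (infCost (kTail P fun ω => 1 / (1 - M ω))
        (kTail P Q)) c (M ω * y + Q ω))) ∂P ≤
      ENNReal.ofReal (Real.exp (potential (infCost (kTail P fun ω => 1 / (1 - M ω))
        (kTail P Q)) c y)) / 2 := by
  set T : Ω → ℝ := fun ω => 1 / (1 - M ω) with hT
  have hTm : Measurable T := by fun_prop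
  set a := kTail P T with ha
  set k := kTail P Q with hk
  set h := infCost a k with hh
  set G := potential h c with hG
  have hrv : MonotoneRV h (gammaIndex α r) := infCost_monotoneRV H
  have hγ := one_lt_gammaIndex H.one_lt_left H.one_lt_right
  have h0 : ∀ x, 0 ≤ h x := infCost_nonneg H.a_nonneg
  have hGm : Monotone G := potential_mono hrv.mono h0 hc0.le
  obtain ⟨θ, hθ0, hθ1, hinc⟩ := H.potential_increment_le hc0 hc
  obtain ⟨η, hη1, hη2⟩ := exists_between hθ1
  set W : Ω → ℝ := fun ω => max (a (T ω)) (k (Q ω)) with hW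
  have hWm : Measurable W := (H.a_mono.measurable.comp hTm).max (H.k_mono.measurable.comp hQ)
  have hW0 : ∀ ω, 0 ≤ W ω := fun ω => le_max_of_le_left (H.a_nonneg _)
  have hr1 : 0 < r - 1 := by have := H.one_lt_right; linarith
  have hα1 : 0 < α := by have := H.one_lt_left; linarith
  have hB : ∫⁻ ω, ENNReal.ofReal (Real.exp (η * W ω)) ∂P < ∞ := by
    have hη0 : 0 < η := hθ0.trans hη1
    calc ∫⁻ ω, ENNReal.ofReal (Real.exp (η * W ω)) ∂P
        ≤ ∫⁻ ω, (ENNReal.ofReal (Real.exp (η * a (T ω))) +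
            ENNReal.ofReal (Real.exp (η * k (Q ω)))) ∂P := by
          refine lintegral_mono fun ω => ?_
          rcases max_choice (a (T ω)) (k (Q ω)) with hm | hm
          · simp only [hW, hm]; exact le_self_add
          · simp only [hW, hm]; exact le_add_self
      _ = ∫⁻ ω, ENNReal.ofReal (Real.exp (η * a (T ω))) ∂P +
            ∫⁻ ω, ENNReal.ofReal (Real.exp (η * k (Q ω))) ∂P := by
          refine lintegral_add_right _ ?_
          have := H.k_mono.measurable
          fun_prop
      _ < ∞ := ENNReal.add_lt_top.2
          ⟨lintegral_exp_mul_kTail_lt_top hTm hr1 hTpos H.a_rv hη0 hη2,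
            lintegral_exp_mul_kTail_lt_top hQ hα1 hQpos H.k_rv hη0 hη2⟩
  set B := ∫⁻ ω, ENNReal.ofReal (Real.exp (η * W ω)) ∂P with hBdef
  set s : ℝ → ℝ := fun y => min (k (√y - 1)) (a (√y)) with hs
  have hslim : Tendsto s atTop atTop := by
    have h1 : Tendsto (fun y : ℝ => √y) atTop atTop := Real.tendsto_sqrt_atTop
    have h2 : Tendsto (fun y : ℝ => √y - 1) atTop atTop :=
      tendsto_atTop_add_const_right _ (-1) h1
    refine tendsto_atTop.2 fun B => ?_
    filter_upwards [((H.k_rv.tendsto_atTop hα1).comp h2).eventually_ge_atTop B,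
      ((H.a_rv.tendsto_atTop hr1).comp h1).eventually_ge_atTop B] with y hy1 hy2
    exact le_min hy1 hy2
  have hsmall : ∀ᶠ y in atTop, B * ENNReal.ofReal (Real.exp (-((η - θ) * s y))) ≤ 1 / 4 := by
    have h1 : Tendsto (fun y => ENNReal.ofReal (Real.exp (-((η - θ) * s y)))) atTop (𝓝 0) := by
      rw [← ENNReal.ofReal_zero]
      refine (ENNReal.continuous_ofReal.tendsto 0).comp
        (Real.tendsto_exp_neg_atTop_nhds_zero.comp (hslim.const_mul_atTop (by linarith)))
    have h2 := ENNReal.Tendsto.const_mul h1 (Or.inr hB.ne)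
    rw [mul_zero] at h2
    exact h2.eventually_le_const (by simp)
  have hdown : ∀ᶠ y in atTop, G (y - 1) + Real.log 4 ≤ G y := by
    have h1 : Tendsto (fun y : ℝ => y - 1) atTop atTop :=
      tendsto_atTop_add_const_right _ (-1) tendsto_id
    filter_upwards [h1.eventually ((hrv.tendsto_div_atTop hγ).eventually_ge_atTop
      (2 * Real.log 4 / c)), eventually_ge_atTop 2] with y hy1 hy
    have h3 := le_potential_sub hrv.mono h0 hc0.le (by linarith : 1 ≤ y - 1)
      (by linarith : y - 1 ≤ y)
    have h4 : h (y - 1) / (y - 1) ≤ 2 * (h (y - 1) / y) := by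
      rw [← mul_div_assoc, div_le_div_iff₀ (by linarith) (by linarith)]
      nlinarith [h0 (y - 1)]
    have h5 : Real.log 4 / c ≤ h (y - 1) / y := by
      have : 2 * Real.log 4 / c = 2 * (Real.log 4 / c) := by ring
      linarith
    rw [div_le_iff₀ hc0] at h5
    have h6 : c * ((y - (y - 1)) * (h (y - 1) / y)) = h (y - 1) / y * c := by ring
    linarith
  filter_upwards [hinc, hsmall, hdown, eventually_gt_atTop 0] with y hy1 hy2 hy3 hy0
  have hpt : ∀ᵐ ω ∂P, ENNReal.ofReal (Real.exp (G (M ω * y + Q ω))) ≤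
      ENNReal.ofReal (Real.exp (G y)) * (1 / 4 +
        ENNReal.ofReal (Real.exp (η * W ω)) * ENNReal.ofReal (Real.exp (-((η - θ) * s y)))) := by
    filter_upwards [hpos, hM1] with ω hω hω1
    have hT1 : 1 ≤ T ω := by
      rw [hT]
      show 1 ≤ 1 / (1 - M ω)
      rw [le_div_iff₀ (by linarith)]; linarith [hω.1]
    have hT0 : 0 < T ω := by linarith
    have hMT : M ω = 1 - 1 / T ω := by
      simp only [hT, one_div_one_div]; ring
    have hyT : M ω * y + Q ω = y + (Q ω - y / T ω) := by rw [hMT]; ring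
    rw [hyT]
    rcases le_or_gt (Q ω - y / T ω) (-1) with hd | hd
    · have h1 : G (y + (Q ω - y / T ω)) ≤ G y + -Real.log 4 := by
        have := hGm (by linarith : y + (Q ω - y / T ω) ≤ y - 1)
        linarith
      calc ENNReal.ofReal (Real.exp (G (y + (Q ω - y / T ω))))
          ≤ ENNReal.ofReal (Real.exp (G y + -Real.log 4)) := by gcongr
        _ = ENNReal.ofReal (Real.exp (G y)) * (1 / 4) := by
          rw [Real.exp_add, ENNReal.ofReal_mul (Real.exp_pos _).le, Real.exp_neg,
            Real.exp_log (by norm_num), ENNReal.ofReal_inv_of_pos (by norm_num), one_div]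
          norm_num
        _ ≤ _ := by gcongr; exact le_self_add
    · have hWs : s y ≤ W ω := by
        rcases le_total (√y) (T ω) with hc | hc
        · exact (min_le_right _ _).trans ((H.a_mono hc).trans (le_max_left _ _))
        · refine (min_le_left _ _).trans ((H.k_mono ?_).trans (le_max_right _ _))
          have h1 : √y ≤ y / T ω := by
            rw [le_div_iff₀ hT0]
            calc √y * T ω ≤ √y * √y := by gcongr
              _ = y := Real.mul_self_sqrt hy0.le
          linarith
      have h1 : G (y + (Q ω - y / T ω)) ≤ G y + θ * W ω := by
        rcases le_or_gt (Q ω - y / T ω) 0 with hd0 | hd0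
        · have h2 := hGm (by linarith : y + (Q ω - y / T ω) ≤ y)
          have h3 := mul_nonneg hθ0.le (hW0 ω)
          linarith
        · have := hy1 (T ω) (Q ω) hT1 hω.2 hd0
          linarith
      have h2 : θ * W ω ≤ η * W ω + -((η - θ) * s y) := by nlinarith
      calc ENNReal.ofReal (Real.exp (G (y + (Q ω - y / T ω))))
          ≤ ENNReal.ofReal (Real.exp (G y + (η * W ω + -((η - θ) * s y)))) := by
            gcongr; linarith
        _ = ENNReal.ofReal (Real.exp (G y)) * (ENNReal.ofReal (Real.exp (η * W ω)) *
              ENNReal.ofReal (Real.exp (-((η - θ) * s y)))) := by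
          rw [Real.exp_add, Real.exp_add, ENNReal.ofReal_mul (Real.exp_pos _).le,
            ENNReal.ofReal_mul (Real.exp_pos _).le]
        _ ≤ _ := by gcongr; exact le_add_self
  calc ∫⁻ ω, ENNReal.ofReal (Real.exp (G (M ω * y + Q ω))) ∂P
      ≤ ∫⁻ ω, ENNReal.ofReal (Real.exp (G y)) * (1 / 4 +
        ENNReal.ofReal (Real.exp (η * W ω)) * ENNReal.ofReal (Real.exp (-((η - θ) * s y)))) ∂P :=
        lintegral_mono_ae hpt
    _ = ENNReal.ofReal (Real.exp (G y)) *
          (1 / 4 + B * ENNReal.ofReal (Real.exp (-((η - θ) * s y)))) := by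
        rw [lintegral_const_mul _ (by fun_prop), lintegral_add_left measurable_const,
          lintegral_mul_const _ (by fun_prop)]
        simp [hBdef]
    _ ≤ ENNReal.ofReal (Real.exp (G y)) * (1 / 4 + 1 / 4) := by gcongr
    _ = ENNReal.ofReal (Real.exp (G y)) / 2 := by
        rw [div_eq_mul_inv _ (2 : ℝ≥0∞)]
        congr 1
        rw [← two_mul, one_div, show (4 : ℝ≥0∞) = 2 * 2 by norm_num,
          ENNReal.mul_inv (by simp) (by simp), ← mul_assoc,
          ENNReal.mul_inv_cancel (by simp) (by simp), one_mul]

/-- The drift condition bounds `E (V R)`, and Markov's inequality bounds the tail of `R`. -/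
theorem IsPerpetuity.eventually_log_tail_le [IsProbabilityMeasure P] {R : Ω → ℝ}
    (hR : IsPerpetuity P M Q R) (hM : Measurable M) (hQ : Measurable Q)
    (hpos : ∀ᵐ ω ∂P, 0 ≤ M ω ∧ 0 ≤ Q ω) (hM1 : ∀ᵐ ω ∂P, M ω < 1)
    (hTpos : ∀ x, 0 < P.real {ω | x < 1 / (1 - M ω)}) (hQpos : ∀ x, 0 < P.real {ω | x < Q ω})
    (H : CostPair (kTail P fun ω => 1 / (1 - M ω)) (kTail P Q) α r) {c : ℝ}
    (hc : c < sharpRate (gammaIndex α r) / gammaIndex α r) :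
    ∀ᶠ x in atTop, Real.log (P.real {ω | x < R ω}) ≤
      -(c * infCost (kTail P fun ω => 1 / (1 - M ω)) (kTail P Q) x) := by
  have hγ := one_lt_gammaIndex H.one_lt_left H.one_lt_right
  set γ := gammaIndex α r with hγd
  have hγ0 : 0 < γ := by linarith
  set h := infCost (kTail P fun ω => 1 / (1 - M ω)) (kTail P Q) with hh
  have hrv : MonotoneRV h γ := infCost_monotoneRV H
  have h0 : ∀ x, 0 ≤ h x := infCost_nonneg H.a_nonneg
  obtain ⟨c₁, hc1, hc1'⟩ := exists_between (max_lt hc (div_pos (sharpRate_pos hγ) hγ0))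
  obtain ⟨c₂, hc2, hc2'⟩ := exists_between hc1'
  have hcc1 : c < c₁ := (le_max_left _ _).trans_lt hc1
  have hc10 : 0 < c₁ := (le_max_right _ _).trans_lt hc1
  have hc20 : 0 < c₂ := hc10.trans hc2
  have hd0 : 0 < c₂ * γ := by positivity
  have hd : c₂ * γ < sharpRate γ := (lt_div_iff₀ hγ0).1 hc2'
  set G := potential h (c₂ * γ) with hG
  have hGm : Monotone G := potential_mono hrv.mono h0 hd0.le
  set V : ℝ → ℝ≥0∞ := fun y => ENNReal.ofReal (Real.exp (G y)) with hV
  have hVmono : Monotone V := fun x y hxy => by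
    have := hGm hxy
    simp only [hV]
    gcongr
  have hR0 := hR.ae_nonneg hpos hM1
  obtain ⟨Y, hY⟩ := eventually_atTop.1
    (drift_of_costPair hM hQ hpos hM1 hTpos hQpos H hd0 hd)
  have hdrift : ∀ y, ∫⁻ ω, V (M ω * y + Q ω) ∂P ≤ V y / 2 + V Y := by
    intro y
    rcases le_total Y y with hy | hy
    · exact (hY y hy).trans le_self_add
    · calc ∫⁻ ω, V (M ω * y + Q ω) ∂P ≤ ∫⁻ ω, V (M ω * Y + Q ω) ∂P := by
            refine lintegral_mono_ae ?_
            filter_upwards [hpos] with ω hω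
            refine hVmono ?_
            have := mul_le_mul_of_nonneg_left hy hω.1
            linarith
        _ ≤ V Y / 2 := hY Y le_rfl
        _ ≤ V Y := ENNReal.half_le_self
        _ ≤ _ := le_add_self
  have hVm : Measurable V := hVmono.measurable
  have hmoment : ∫⁻ ω, V (R ω) / 2 ∂P ≤ V Y := by
    refine lintegral_le_of_truncated_drift (v := fun ω => V (R ω)) (hVm.comp hR.measurable)
      (fun ω => ENNReal.ofReal_ne_top) fun N => ?_
    rw [hR.lintegral_eq hM hQ (F := fun y => min (V y) N) (by fun_prop)]
    refine lintegral_mono fun ω' => le_min ?_ ?_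
    · exact (lintegral_mono fun ω => min_le_left _ _).trans (hdrift _)
    · calc ∫⁻ ω, min (V (M ω * R ω' + Q ω)) (N : ℝ≥0∞) ∂P ≤ ∫⁻ _, (N : ℝ≥0∞) ∂P :=
            lintegral_mono fun ω => min_le_right _ _
        _ = N := by simp
  have hchern : ∀ x, Real.exp (G x) * P.real {ω | x < R ω} ≤ 2 * Real.exp (G Y) := by
    intro x
    have h1 : V x / 2 * P {ω | x < R ω} ≤ V Y := by
      calc V x / 2 * P {ω | x < R ω} ≤ V x / 2 * P {ω | V x / 2 ≤ V (R ω) / 2} := by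
            refine mul_le_mul_right (measure_mono ?_) _
            intro ω (hω : x < R ω)
            exact ENNReal.div_le_div_right (hVmono hω.le) 2
        _ ≤ ∫⁻ ω, V (R ω) / 2 ∂P :=
            mul_meas_ge_le_lintegral ((hVm.comp hR.measurable).div_const 2) _
        _ ≤ V Y := hmoment
    have h2 := ENNReal.toReal_mono ENNReal.ofReal_ne_top h1
    rw [ENNReal.toReal_mul, ENNReal.toReal_div, ENNReal.toReal_ofReal (Real.exp_pos _).le,
      ENNReal.toReal_ofReal (Real.exp_pos _).le] at h2
    have h3 : (2 : ℝ≥0∞).toReal = 2 := rfl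
    have h4 : (P {ω | x < R ω}).toReal = P.real {ω | x < R ω} := rfl
    rw [h3, h4] at h2
    linarith
  have hGlow := hrv.eventually_mul_le_potential h0 hγ0 hd0 (c' := c₁)
    (by rw [mul_div_cancel_right₀ _ hγ0.ne']; exact hc2)
  filter_upwards [hGlow, (hrv.tendsto_atTop hγ0).eventually_ge_atTop
    ((Real.log 2 + G Y) / (c₁ - c))] with x hx1 hx2
  have hRx : 0 < P.real {ω | x < R ω} := (hQpos x).trans_le (hR.tail_le hpos hR0 x)
  have h1 := Real.log_le_log (by positivity) (hchern x)
  rw [Real.log_mul (by positivity) hRx.ne', Real.log_mul (by norm_num) (by positivity),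
    Real.log_exp, Real.log_exp] at h1
  rw [div_le_iff₀ (by linarith)] at hx2
  have hx1' : c₁ * h x ≤ G x := hx1
  linarith

end Drift

end UpperBound

/-! ### The lower bound for comonotonic generators -/

/-- To pass from `y` to `b y`, where `b = 1 + δ`, repeat one step that is near-optimal for the level
`z = ρ b y`; here `ρ = γ / (γ - 1)` is the optimal ratio between the aim and the present level.
The assumption on `φ` is the one-step inequality for the logarithmic tail of the perpetuity. -/
theorem CostPair.eventually_block_le {a k φ : ℝ → ℝ} {α r : ℝ} (H : CostPair a k α r)
    (hφ : Monotone φ)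
    (hstep : ∀ y t q, 0 ≤ y → 1 ≤ t → φ (y - y / t + q) ≤ φ y + max (a t) (k q))
    {c : ℝ} (hc : sharpRate (gammaIndex α r) < c) :
    ∃ δ > 0, ∀ᶠ y in atTop, φ ((1 + δ) * y) ≤ φ y + δ * c * infCost a k y := by
  have hγ1 := one_lt_gammaIndex H.one_lt_left H.one_lt_right
  set γ := gammaIndex α r with hγ
  set h := infCost a k with hh
  have hrv : MonotoneRV h γ := infCost_monotoneRV H
  have h0 : ∀ x, 0 ≤ h x := infCost_nonneg H.a_nonneg
  have hκ := sharpRate_pos hγ1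
  obtain ⟨c₁, hc1, hc1'⟩ := exists_between hc
  have hc10 : 0 < c₁ := hκ.trans hc1
  -- three factors `e` are lost: to the choice of `t`, to the ratio `h z / h y`, and to rounding
  -- the number of steps up
  obtain ⟨e, he1, he⟩ : ∃ e : ℝ, 1 < e ∧ c₁ * e ^ 3 = c := by
    have h1 : 1 < c / c₁ := (one_lt_div hc10).2 hc1'
    refine ⟨(c / c₁) ^ ((1 : ℝ) / 3), Real.one_lt_rpow h1 (by norm_num), ?_⟩
    rw [← Real.rpow_natCast, ← Real.rpow_mul (by linarith)]
    norm_num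
    field_simp
  have he0 : 0 < e := by linarith
  obtain ⟨δ, hδ0, hδ⟩ : ∃ δ : ℝ, 0 < δ ∧ sharpRate γ * (1 + δ) ^ γ < c₁ := by
    have hcont : ContinuousAt (fun δ : ℝ => sharpRate γ * (1 + δ) ^ γ) 0 :=
      continuousAt_const.mul (ContinuousAt.rpow_const (by fun_prop) (Or.inr (by linarith)))
    have hev : ∀ᶠ δ in 𝓝[>] (0 : ℝ), sharpRate γ * (1 + δ) ^ γ < c₁ :=
      (hcont.eventually_lt_const (by simpa using hc1)).filter_mono nhdsWithin_le_nhds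
    obtain ⟨δ, h1, h2⟩ := (hev.and self_mem_nhdsWithin).exists
    exact ⟨δ, h2, h1⟩
  have hγ2 : 0 < γ - 1 := by linarith
  set ρ := γ / (γ - 1) with hρ
  have hρ1 : 1 < ρ := by rw [hρ, one_lt_div hγ2]; linarith
  have hρ2 : 0 < ρ - 1 := by linarith
  have hρ0 : 0 < ρ := by linarith
  have hρκ : ρ ^ γ = sharpRate γ * (ρ - 1) := (sharpRate_mul_sub_one hγ1).symm
  set b := 1 + δ with hb
  have hb1 : 1 < b := by linarith
  have hb0 : 0 < b := by linarith
  set T₀ := ρ / (δ * (e - 1)) with hT₀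
  have he10 : 0 < e - 1 := by linarith
  have hT₀0 : 0 < T₀ := by positivity
  have hlim : Tendsto (fun y : ℝ => ρ * b * y) atTop atTop :=
    tendsto_id.const_mul_atTop (by positivity)
  refine ⟨δ, hδ0, ?_⟩
  filter_upwards [hlim.eventually (exists_near_optimal H hT₀0 he1),
    hrv.eventually_le_mul (t := ρ * b) (c := e * (ρ * b) ^ γ) (by positivity)
      (lt_mul_of_one_lt_left (by positivity) he1), eventually_gt_atTop 0] with y hy1 hy2 hy
  obtain ⟨t, ht, htT, -, hopt⟩ := hy1
  have ht0 : 0 < t := by linarith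
  set z := ρ * b * y with hz
  set W := max (a t) (k (z / t)) with hW
  have hW0 : 0 ≤ W := le_max_of_le_left (H.a_nonneg _)
  set D := (ρ - 1) * b * y / t with hD
  have hD0 : 0 < D := by positivity
  -- from any level in `[y, b y]` one step with cost `W` gains at least `D`
  have hiter : ∀ n : ℕ, φ (min (y + n * D) (b * y)) ≤ φ y + n * W := by
    intro n
    induction n with
    | zero => simpa using hφ (min_le_left y (b * y))
    | succ n ih =>
      set u := min (y + n * D) (b * y) with hu
      have hyb : y ≤ b * y := le_mul_of_one_le_left hy.le hb1.le
      have hnD : 0 ≤ n * D := by positivity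
      have hu0 : 0 ≤ u := le_min (by linarith) (by linarith)
      have hub : u ≤ b * y := min_le_right _ _
      have h1 : u + D ≤ u - u / t + z / t := by
        have h2 : u / t ≤ b * y / t := by gcongr
        have h3 : z / t - b * y / t = D := by rw [hz, hD]; ring
        linarith
      have h4 : min (y + (n + 1 : ℕ) * D) (b * y) ≤ u + D := by
        rw [hu, ← min_add_add_right]
        refine min_le_min ?_ (by linarith)
        push_cast; linarith
      have h5 := hstep u t (z / t) hu0 ht
      have h6 := hφ (h4.trans h1)
      calc φ (min (y + (n + 1 : ℕ) * D) (b * y)) ≤ φ u + W := h6.trans h5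
        _ ≤ φ y + n * W + W := by gcongr
        _ = φ y + (n + 1 : ℕ) * W := by push_cast; ring
  obtain ⟨n, hn1, hn2⟩ : ∃ n : ℕ, δ * y / D ≤ n ∧ (n : ℝ) ≤ δ * y / D + 1 :=
    ⟨⌈δ * y / D⌉₊, Nat.le_ceil _, (Nat.ceil_lt_add_one (by positivity)).le⟩
  have hreach : b * y ≤ y + n * D := by
    rw [div_le_iff₀ hD0] at hn1
    rw [hb]; linarith
  have h1 := hiter n
  rw [min_eq_right hreach] at h1
  have h2 : n * W ≤ δ * c * h y := by
    have hTinv : 1 / t ≤ δ * (e - 1) / ρ := by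
      rw [← one_div_div ρ]
      exact one_div_le_one_div_of_le hT₀0 htT
    have hz2 : h z ≤ e * (ρ * b) ^ γ * h y := hy2
    have hyy := h0 y
    have hzz := h0 z
    calc n * W ≤ (δ * y / D + 1) * W := by gcongr
      _ = (δ / ((ρ - 1) * b) + 1 / t) * (t * W) := by rw [hD]; field_simp
      _ ≤ (δ / ((ρ - 1) * b) + 1 / t) * (e * h z) := by gcongr
      _ ≤ (δ / (ρ - 1) + δ * (e - 1) / (ρ - 1)) * (e * (e * (ρ * b) ^ γ * h y)) := by
        have h3 : δ / ((ρ - 1) * b) ≤ δ / (ρ - 1) := by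
          gcongr
          exact le_mul_of_one_le_right hρ2.le hb1.le
        have h4 : 1 / t ≤ δ * (e - 1) / (ρ - 1) := by
          refine hTinv.trans ?_
          gcongr
          linarith
        exact mul_le_mul (add_le_add h3 h4) (by gcongr) (by positivity) (by positivity)
      _ = δ * (sharpRate γ * b ^ γ) * e ^ 3 * h y := by
        rw [Real.mul_rpow hρ0.le hb0.le, hρκ]; field_simp; ring
      _ ≤ δ * c₁ * e ^ 3 * h y := by gcongr
      _ = δ * c * h y := by rw [← he]; ring
  linarith

/-- Summation of the block estimates: by Bernoulli's inequality `h (b y) - h y` is at least about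
`γ δ h y`, so `φ - c₁ h` does not increase along `y ↦ b y` once `c₁` exceeds `sharpRate γ / γ`. -/
theorem CostPair.eventually_le_mul_infCost {a k φ : ℝ → ℝ} {α r : ℝ} (H : CostPair a k α r)
    (hφ : Monotone φ)
    (hstep : ∀ y t q, 0 ≤ y → 1 ≤ t → φ (y - y / t + q) ≤ φ y + max (a t) (k q))
    {c : ℝ} (hc : sharpRate (gammaIndex α r) / gammaIndex α r < c) :
    ∀ᶠ x in atTop, φ x ≤ c * infCost a k x := by
  have hγ1 := one_lt_gammaIndex H.one_lt_left H.one_lt_right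
  have hrv : MonotoneRV (infCost a k) (gammaIndex α r) := infCost_monotoneRV H
  set γ := gammaIndex α r with hγ
  set h := infCost a k with hh
  have h0 : ∀ x, 0 ≤ h x := infCost_nonneg H.a_nonneg
  have hγ0 : 0 < γ := by linarith
  obtain ⟨c₁, hc1, hc1'⟩ := exists_between hc
  have hc10 : 0 < c₁ := (div_pos (sharpRate_pos hγ1) hγ0).trans hc1
  rw [div_lt_iff₀ hγ0] at hc1
  obtain ⟨d, hd, hd'⟩ := exists_between hc1
  obtain ⟨δ, hδ0, hblock⟩ := H.eventually_block_le hφ hstep hd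
  set b := 1 + δ with hb
  have hb1 : 1 < b := by linarith
  have hgrow : 1 + δ * (d / c₁) < b ^ γ := by
    have h1 := one_add_mul_self_le_rpow_one_add (s := δ) (by linarith) hγ1.le
    have h2 : d / c₁ < γ := by rwa [div_lt_iff₀ hc10, mul_comm]
    have h3 : δ * (d / c₁) < δ * γ := by gcongr
    linarith
  obtain ⟨Y, hY⟩ := eventually_atTop.1
    (hblock.and (hrv.eventually_mul_le (by linarith) hgrow))
  set y₀ := max Y 1 with hy₀
  have hy₀0 : 0 < y₀ := lt_max_of_lt_right one_pos
  -- `φ - c₁ h` does not increase along `y ↦ b y`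
  have hdesc : ∀ y, y₀ ≤ y → φ (b * y) - c₁ * h (b * y) ≤ φ y - c₁ * h y := by
    intro y hy
    obtain ⟨h1, h2⟩ := hY y ((le_max_left _ _).trans hy)
    have h3 : c₁ * ((1 + δ * (d / c₁)) * h y) ≤ c₁ * h (b * y) := by gcongr
    have h4 : c₁ * ((1 + δ * (d / c₁)) * h y) = c₁ * h y + δ * d * h y := by field_simp
    linarith
  have hiter : ∀ n : ℕ, ∀ y, y₀ ≤ y → φ (b ^ n * y) - c₁ * h (b ^ n * y) ≤ φ y - c₁ * h y := by
    intro n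
    induction n with
    | zero => intro y _; simp
    | succ n ih =>
      intro y hy
      have h1 : y ≤ b ^ n * y :=
        le_mul_of_one_le_left (hy₀0.le.trans hy) (one_le_pow₀ hb1.le)
      have h2 := hdesc (b ^ n * y) (hy.trans h1)
      rw [← mul_assoc, ← pow_succ'] at h2
      exact h2.trans (ih y hy)
  filter_upwards [eventually_ge_atTop y₀, (hrv.tendsto_atTop hγ0).eventually_ge_atTop
    (φ (b * y₀) / (c - c₁))] with x hx hx2
  obtain ⟨n, hn1, hn2⟩ := exists_nat_pow_near (x := x / y₀)
    (by rwa [le_div_iff₀ hy₀0, one_mul]) hb1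
  have hbn : 0 < b ^ n := by positivity
  have hu1 : y₀ ≤ x / b ^ n := by
    rw [le_div_iff₀ hy₀0] at hn1
    rw [le_div_iff₀ hbn]; linarith
  have hu2 : x / b ^ n ≤ b * y₀ := by
    rw [div_lt_iff₀ hy₀0] at hn2
    rw [div_le_iff₀ hbn]
    calc x ≤ b ^ (n + 1) * y₀ := hn2.le
      _ = b * y₀ * b ^ n := by ring
  have h1 := hiter n _ hu1
  rw [mul_div_cancel₀ _ hbn.ne'] at h1
  have h2 := hφ hu2
  have h3 := mul_nonneg hc10.le (h0 (x / b ^ n))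
  rw [div_le_iff₀ (by linarith)] at hx2
  linarith

section LowerBound

variable {Ω : Type*} [MeasurableSpace Ω] {P : Measure Ω}

lemma IsComonotonic.joint_tail [IsProbabilityMeasure P] {X Y : Ω → ℝ} (h : IsComonotonic P X Y)
    (hX : Measurable X) (hY : Measurable Y) (x y : ℝ) :
    P.real {ω | x < X ω ∧ y < Y ω} = min (P.real {ω | x < X ω}) (P.real {ω | y < Y ω}) := by
  have hA : MeasurableSet {ω | X ω ≤ x} := measurableSet_le hX measurable_const
  have hB : MeasurableSet {ω | Y ω ≤ y} := measurableSet_le hY measurable_const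
  have e1 : {ω | x < X ω} = {ω | X ω ≤ x}ᶜ := by ext; simp
  have e2 : {ω | y < Y ω} = {ω | Y ω ≤ y}ᶜ := by ext; simp
  have e3 : {ω | x < X ω ∧ y < Y ω} = ({ω | X ω ≤ x} ∪ {ω | Y ω ≤ y})ᶜ := by ext; simp
  have h1 := measureReal_union_add_inter (μ := P) (s := {ω | X ω ≤ x}) hB
  have h2 : P.real ({ω | X ω ≤ x} ∩ {ω | Y ω ≤ y}) =
    min (P.real {ω | X ω ≤ x}) (P.real {ω | Y ω ≤ y}) := h x y
  rw [e1, e2, e3, probReal_compl_eq_one_sub hA, probReal_compl_eq_one_sub hB,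
    probReal_compl_eq_one_sub (hA.union hB), min_sub_sub_left]
  have h3 := min_add_max (P.real {ω | X ω ≤ x}) (P.real {ω | Y ω ≤ y})
  linarith

/-- If `R > y`, `1 / (1 - M) > t` and `Q > q`, then `M R + Q > y - y / t + q`; the first event is
independent of the other two, whose joint probability is the smaller of the two by
comonotonicity. -/
theorem IsPerpetuity.kTail_step [IsProbabilityMeasure P] {M Q R : Ω → ℝ}
    (hR : IsPerpetuity P M Q R) (hco : IsComonotonic P M Q) (hM : Measurable M) (hQ : Measurable Q)
    (hM1 : ∀ᵐ ω ∂P, M ω < 1)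
    (hTpos : ∀ x, 0 < P.real {ω | x < 1 / (1 - M ω)}) (hQpos : ∀ x, 0 < P.real {ω | x < Q ω})
    (hRpos : ∀ x, 0 < P.real {ω | x < R ω}) {y t : ℝ} (q : ℝ) (hy : 0 ≤ y) (ht : 1 ≤ t) :
    kTail P R (y - y / t + q) ≤
      kTail P R y + max (kTail P (fun ω => 1 / (1 - M ω)) t) (kTail P Q q) := by
  have ht0 : 0 < t := by linarith
  have hT : P.real {ω | t < 1 / (1 - M ω)} = P.real {ω | 1 - 1 / t < M ω} := by
    refine measureReal_congr ?_
    filter_upwards [hM1] with ω hω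
    refine propext ?_
    change t < 1 / (1 - M ω) ↔ 1 - 1 / t < M ω
    rw [lt_one_div ht0 (by linarith)]
    constructor <;> intro <;> linarith
  set A : Set (ℝ × ℝ) := {p | 1 - 1 / t < p.1 ∧ q < p.2} with hA
  have hAm : MeasurableSet A := measurableSet_Ioi.prod measurableSet_Ioi
  have hind := hR.indep.measure_inter_preimage_eq_mul A (Set.Ioi y) hAm measurableSet_Ioi
  have hle : P ((fun ω => (M ω, Q ω)) ⁻¹' A ∩ R ⁻¹' Set.Ioi y) ≤
      P {ω | y - y / t + q < R ω} := by
    have h1 : P {ω | y - y / t + q < R ω} = P {ω | y - y / t + q < M ω * R ω + Q ω} :=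
      hR.identDistrib.measure_mem_eq measurableSet_Ioi
    rw [h1]
    refine measure_mono ?_
    rintro ω ⟨⟨h2, h3⟩, h4⟩
    have h2' : 1 - 1 / t < M ω := h2
    have h3' : q < Q ω := h3
    have h4' : y < R ω := h4
    have h5 : 0 ≤ 1 - 1 / t := by
      rw [sub_nonneg, div_le_one ht0]; exact ht
    have h6 : (1 - 1 / t) * y ≤ M ω * R ω := mul_le_mul h2'.le h4'.le hy (h5.trans h2'.le)
    have h7 : (1 - 1 / t) * y = y - y / t := by ring
    show y - y / t + q < M ω * R ω + Q ω
    linarith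
  rw [hind] at hle
  have hreal := ENNReal.toReal_mono (measure_ne_top _ _) hle
  rw [ENNReal.toReal_mul] at hreal
  have hj : (P ((fun ω => (M ω, Q ω)) ⁻¹' A)).toReal =
      min (P.real {ω | t < 1 / (1 - M ω)}) (P.real {ω | q < Q ω}) := by
    rw [hT]; exact hco.joint_tail hM hQ _ _
  have hmin : 0 < min (P.real {ω | t < 1 / (1 - M ω)}) (P.real {ω | q < Q ω}) :=
    lt_min (hTpos t) (hQpos q)
  rw [hj] at hreal
  have hlog := Real.log_le_log (mul_pos hmin (hRpos y)) hreal
  change Real.log (_ * P.real {ω | y < R ω}) ≤ Real.log (P.real {ω | y - y / t + q < R ω}) at hlog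
  rw [Real.log_mul hmin.ne' (hRpos y).ne'] at hlog
  have hmax : -Real.log (min (P.real {ω | t < 1 / (1 - M ω)}) (P.real {ω | q < Q ω})) ≤
      max (kTail P (fun ω => 1 / (1 - M ω)) t) (kTail P Q q) := by
    rcases min_choice (P.real {ω | t < 1 / (1 - M ω)}) (P.real {ω | q < Q ω}) with h | h
    · rw [h]; exact le_max_left _ _
    · rw [h]; exact le_max_right _ _
  unfold kTail at *
  linarith

end LowerBound

/-! ### Logarithmic asymptotics of the perpetuity -/

lemma sharpRate_div_self {p : ℝ} (hp : p ≠ 0) : sharpRate p / p = (p / (p - 1)) ^ (p - 1) :=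
  mul_div_cancel_left₀ _ hp

section Asymptotics

variable {Ω : Type*} [MeasurableSpace Ω] {P : Measure Ω}

lemma IsPerpetuity.congr_ae {M Q M' Q' R : Ω → ℝ} (hR : IsPerpetuity P M Q R) (hM : M =ᵐ[P] M')
    (hQ : Q =ᵐ[P] Q') : IsPerpetuity P M' Q' R where
  measurable := hR.measurable
  indep := hR.indep.congr (by filter_upwards [hM, hQ] with ω h1 h2; rw [h1, h2]) .rfl
  identDistrib := hR.identDistrib.trans <| IdentDistrib.of_ae_eq hR.identDistrib.aemeasurable_snd
    (by filter_upwards [hM, hQ] with ω h1 h2; rw [h1, h2])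

lemma IsComonotonic.congr_ae {X Y X' Y' : Ω → ℝ} (h : IsComonotonic P X Y) (hX : X =ᵐ[P] X')
    (hY : Y =ᵐ[P] Y') : IsComonotonic P X' Y' := by
  intro x y
  have e1 : P.real {ω | X' ω ≤ x ∧ Y' ω ≤ y} = P.real {ω | X ω ≤ x ∧ Y ω ≤ y} :=
    measureReal_congr <| by
      filter_upwards [hX, hY] with ω h1 h2
      change (X' ω ≤ x ∧ Y' ω ≤ y) = (X ω ≤ x ∧ Y ω ≤ y)
      rw [h1, h2]
  have e2 : P.real {ω | X' ω ≤ x} = P.real {ω | X ω ≤ x} :=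
    measureReal_congr <| by
      filter_upwards [hX] with ω h1
      change (X' ω ≤ x) = (X ω ≤ x)
      rw [h1]
  have e3 : P.real {ω | Y' ω ≤ y} = P.real {ω | Y ω ≤ y} :=
    measureReal_congr <| by
      filter_upwards [hY] with ω h1
      change (Y' ω ≤ y) = (Y ω ≤ y)
      rw [h1]
  rw [e1, e2, e3]
  exact h x y

theorem eventually_log_tail_div_hco_le [IsProbabilityMeasure P] {M Q R : Ω → ℝ} {α r : ℝ}
    (hM : Measurable M) (hQ : Measurable Q) (hpos : ∀ᵐ ω ∂P, 0 ≤ M ω ∧ 0 ≤ Q ω)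
    (hα : 1 < α) (hr : 1 < r) (hk : IsRegularlyVarying (kTail P Q) α)
    (hf : IsRegularlyVarying (fTail P M) r) (hR : IsPerpetuity P M Q R) {c : ℝ}
    (hc : -(sharpRate (gammaIndex α r) / gammaIndex α r) < c) :
    ∀ᶠ x in atTop, Real.log (P.real {ω | x < R ω}) / hco P M Q x ≤ c := by
  have H := costPair_of_isRegularlyVarying hα hr hk hf
  have hTpos := tail_inv_one_sub_pos hr hf
  have hQpos := tail_pos_of_isRegularlyVarying hk
  have hlog := hR.eventually_log_tail_le hM hQ hpos (ae_lt_one hr hf) hTpos hQpos H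
    (c := -c) (by linarith)
  filter_upwards [hlog, (infCost_monotoneRV H).pos] with x hx hx0
  rw [hco_eq_infCost hTpos hQpos, div_le_iff₀ hx0]
  linarith

theorem eventually_le_log_tail_div_hco [IsProbabilityMeasure P] {M Q R : Ω → ℝ} {α r : ℝ}
    (hM : Measurable M) (hQ : Measurable Q) (hpos : ∀ᵐ ω ∂P, 0 ≤ M ω ∧ 0 ≤ Q ω)
    (hα : 1 < α) (hr : 1 < r) (hk : IsRegularlyVarying (kTail P Q) α)
    (hf : IsRegularlyVarying (fTail P M) r) (hcom : IsComonotonic P M Q)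
    (hR : IsPerpetuity P M Q R) {c : ℝ}
    (hc : c < -(sharpRate (gammaIndex α r) / gammaIndex α r)) :
    ∀ᶠ x in atTop, c ≤ Real.log (P.real {ω | x < R ω}) / hco P M Q x := by
  have H := costPair_of_isRegularlyVarying hα hr hk hf
  have hTpos := tail_inv_one_sub_pos hr hf
  have hQpos := tail_pos_of_isRegularlyVarying hk
  have hM1 := ae_lt_one hr hf
  have hRpos : ∀ x, 0 < P.real {ω | x < R ω} := fun x =>
    (hQpos x).trans_le (hR.tail_le hpos (hR.ae_nonneg hpos hM1) x)
  have hlog := H.eventually_le_mul_infCost (φ := kTail P R) (c := -c) (kTail_mono hRpos)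
    (fun y t q hy ht => hR.kTail_step hcom hM hQ hM1 hTpos hQpos hRpos q hy ht) (by linarith)
  filter_upwards [hlog, (infCost_monotoneRV H).pos] with x hx hx0
  rw [hco_eq_infCost hTpos hQpos, le_div_iff₀ hx0]
  unfold kTail at hx ⊢
  linarith

end Asymptotics

end Perpetuity

theorem theorem5p1
    {Ω : Type*} [MeasurableSpace Ω] (P : Measure Ω) [IsProbabilityMeasure P]
    (M Q : Ω → ℝ) (hM : Measurable M) (hQ : Measurable Q)
    (hpos : ∀ᵐ ω ∂P, 0 ≤ M ω ∧ 0 ≤ Q ω)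
    (α r : ℝ) (hα : 1 < α) (hr : 1 < r)
    (hk : Perpetuity.IsRegularlyVarying (Perpetuity.kTail P Q) α)
    (hf : Perpetuity.IsRegularlyVarying (Perpetuity.fTail P M) r)
    (γ : ℝ) (hγ : γ = Perpetuity.gammaIndex α r) :
    -- arbitrary dependence between `M` and `Q`; the quotient may tend to `-∞`,
    -- hence the upper limit is taken in the extended reals
    (∀ R : Ω → ℝ, Perpetuity.IsPerpetuity P M Q R →
      limsup (fun x : ℝ =>
          ((Real.log (P.real {ω | x < R ω}) / Perpetuity.hco P M Q x : ℝ) : EReal)) atTop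
        ≤ ((-(γ / (γ - 1)) ^ (γ - 1) : ℝ) : EReal)) ∧
    -- comonotonic generator with the same marginals, on any probability space
    (∀ (Ω' : Type*) [MeasurableSpace Ω'] (P' : Measure Ω') [IsProbabilityMeasure P']
        (Mco Qco Rco : Ω' → ℝ),
      IdentDistrib Mco M P' P → IdentDistrib Qco Q P' P →
      Perpetuity.IsComonotonic P' Mco Qco →
      Perpetuity.IsPerpetuity P' Mco Qco Rco →
      Tendsto (fun x : ℝ =>
          Real.log (P'.real {ω | x < Rco ω}) / Perpetuity.hco P M Q x) atTop
        (𝓝 (-(γ / (γ - 1)) ^ (γ - 1)))) := by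
  have hγ1 : 1 < γ := hγ ▸ Perpetuity.one_lt_gammaIndex hα hr
  have hconst : -(γ / (γ - 1)) ^ (γ - 1) =
      -(Perpetuity.sharpRate (Perpetuity.gammaIndex α r) / Perpetuity.gammaIndex α r) := by
    rw [← hγ, Perpetuity.sharpRate_div_self (by linarith)]
  rw [hconst]
  refine ⟨fun R hR => ?_, ?_⟩
  · rw [limsup_le_iff]
    intro y hy
    obtain ⟨c, hc1, hc2⟩ := EReal.lt_iff_exists_real_btwn.1 hy
    filter_upwards [Perpetuity.eventually_log_tail_div_hco_le hM hQ hpos hα hr hk hf hR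
      (EReal.coe_lt_coe_iff.1 hc1)] with x hx
    exact (EReal.coe_le_coe_iff.2 hx).trans_lt hc2
  · intro Ω' _ P' _ Mco Qco Rco hMid hQid hcom hR
    -- `IdentDistrib` provides almost everywhere measurability only
    set M' := hMid.aemeasurable_fst.mk Mco
    set Q' := hQid.aemeasurable_fst.mk Qco
    have hMae : Mco =ᵐ[P'] M' := hMid.aemeasurable_fst.ae_eq_mk
    have hQae : Qco =ᵐ[P'] Q' := hQid.aemeasurable_fst.ae_eq_mk
    have hM'm : Measurable M' := hMid.aemeasurable_fst.measurable_mk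
    have hQ'm : Measurable Q' := hQid.aemeasurable_fst.measurable_mk
    have hM'id : IdentDistrib M' M P' P :=
      (IdentDistrib.of_ae_eq hMid.aemeasurable_fst hMae).symm.trans hMid
    have hQ'id : IdentDistrib Q' Q P' P :=
      (IdentDistrib.of_ae_eq hQid.aemeasurable_fst hQae).symm.trans hQid
    have hcom' := hcom.congr_ae hMae hQae
    have hR' := hR.congr_ae hMae hQae
    have hMreal : ∀ s : Set ℝ, MeasurableSet s → P'.real (M' ⁻¹' s) = P.real (M ⁻¹' s) :=
      fun s hs => congrArg ENNReal.toReal (hM'id.measure_mem_eq hs)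
    have hQreal : ∀ s : Set ℝ, MeasurableSet s → P'.real (Q' ⁻¹' s) = P.real (Q ⁻¹' s) :=
      fun s hs => congrArg ENNReal.toReal (hQ'id.measure_mem_eq hs)
    have hk' : Perpetuity.kTail P' Q' = Perpetuity.kTail P Q := by
      ext x
      exact congrArg (fun p => -Real.log p) (hQreal (Set.Ioi x) measurableSet_Ioi)
    have hf' : Perpetuity.fTail P' M' = Perpetuity.fTail P M := by
      ext x
      exact congrArg (fun p => -x * Real.log p) (hMreal (Set.Ici (1 - 1 / x)) measurableSet_Ici)
    have hhco : Perpetuity.hco P' M' Q' = Perpetuity.hco P M Q := by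
      ext x
      unfold Perpetuity.hco
      refine iInf_congr fun t => ?_
      have h1 : P'.real {ω | (t : ℝ) < 1 / (1 - M' ω)} = P.real {ω | (t : ℝ) < 1 / (1 - M ω)} :=
        hMreal {m | (t : ℝ) < 1 / (1 - m)} (measurableSet_lt measurable_const (by fun_prop))
      have h2 : P'.real {ω | x / (t : ℝ) < Q' ω} = P.real {ω | x / (t : ℝ) < Q ω} :=
        hQreal (Set.Ioi (x / t)) measurableSet_Ioi
      rw [h1, h2]
    have hpos' : ∀ᵐ ω ∂P', 0 ≤ M' ω ∧ 0 ≤ Q' ω := by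
      have h1 := hM'id.symm.ae_mem_snd (t := Set.Ici 0) measurableSet_Ici
        (hpos.mono fun ω h => h.1)
      have h2 := hQ'id.symm.ae_mem_snd (t := Set.Ici 0) measurableSet_Ici
        (hpos.mono fun ω h => h.2)
      exact h1.and h2
    rw [← hk'] at hk
    rw [← hf'] at hf
    rw [← hhco]
    refine tendsto_order.2 ⟨fun c hc => ?_, fun c hc => ?_⟩
    · obtain ⟨d, hd1, hd2⟩ := exists_between hc
      filter_upwards [Perpetuity.eventually_le_log_tail_div_hco hM'm hQ'm hpos' hα hr hk hf
        hcom' hR' hd2] with x hx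
      exact hd1.trans_le hx
    · obtain ⟨d, hd1, hd2⟩ := exists_between hc
      filter_upwards [Perpetuity.eventually_log_tail_div_hco_le hM'm hQ'm hpos' hα hr hk hf
        hR' hd1] with x hx
      exact hx.trans_lt hd2
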